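/- Let $\mathbf{k}$ be a field of characteristic $0$; all vector spaces and tensor products are over $\mathbf{k}$. **Braided dendriform algebras.** A braiding on a vector space $V$ is a linear map $\sigma: V\otimes V\to V\otimes V$ (not necessarily invertible) with $(\sigma\otimes \mathrm{id})(\mathrm{id}\otimes\sigma)(\sigma\otimes \mathrm{id})=(\mathrm{id}\otimes\sigma)(\sigma\otimes \mathrm{id})(\mathrm{id}\otimes\sigma)$ on $V^{\otimes 3}$; then $(V,\sigma)$ is a braided vector space. We write $\sigma_i$ for $\sigma$ acting on the $i$-th and $(i+1)$-th factors of $V^{\otimes n}$. A homomorphism $(V,\sigma)\to(V',\sigma')$ of braided vector spaces is a linear map $f$ with $(f\otimes f)\sigma=\sigma'(f\otimes f)$. A dendriform algebra is a vector space $D$ with bilinear operations $\prec,\succ$ such that for all $x,y,z\in D$ $$(x\prec y)\prec z=x\prec(y\prec z+y\succ z),\quad (x\succ y)\prec z=x\succ(y\prec z),\quad (x\prec y+x\succ y)\succ z=x\succ(y\succ z).$$ A braided dendriform algebra $(D,\prec,\succ,\tau)$ is a dendriform algebra with a braiding $\tau$ on $D$ such that, for each operation $\circ\in\{\prec,\succ\}$,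 $$\tau(\mathrm{id}\otimes\circ)=(\circ\otimes\mathrm{id})\tau_2\tau_1,\qquad \tau(\circ\otimes\mathrm{id})=(\mathrm{id}\otimes\circ)\tau_1\tau_2 .$$ A homomorphism of braided dendriform algebras is a homomorphism of braided vector spaces preserving $\prec$ and $\succ$. **Trees.** Let $\mathcal{B}_n$ be the set of planar binary trees with $n$ internal vertices, so that $\mathcal{B}_0=\{|\}$. For a vector space $V$ put $$\mathcal{Y}(V)=\bigoplus_{n\ge 0}\mathbf{k}\mathcal{B}_n\otimes V^{\otimes n},\qquad \overline{\mathcal{Y}(V)}=\bigoplus_{n\ge 1}\mathbf{k}\mathcal{B}_n\otimes V^{\otimes n}.$$ The element $Y(v_1,\dots,v_n):=Y\otimes(v_1\otimes\cdots\otimes v_n)$ is viewed as the tree $Y$ with its internal vertices, ordered from left to right (in-order), decorated by $v_1,\dots,v_n$. Let $Y\vee_v Y'$ be the tree with root vertex decorated by $v$, left branch $Y$ and right branch $Y'$ (extended linearly), and let $Y[v]=|\vee_v|$. Define bilinear operations $\prec_\sigma,\succ_\sigma$ on $\overline{\mathcal{Y}(V)}$ recursively by $$Y\prec_\sigma Y'=Y_1\vee_u(Y_2*_\sigma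 Y'),\qquad Y\succ_\sigma Y'=(Y*_\sigma Y_1')\vee_v Y_2'$$ for $Y=Y_1\vee_uY_2$ and $Y'=Y_1'\vee_vY_2'$, where $*_\sigma=\prec_\sigma+\succ_\sigma$ on $\overline{\mathcal{Y}(V)}$ and $|$ is a two-sided unit for $*_\sigma$. Let $\sigma$ be a braiding on $V$. For $m,n\ge 1$ let $\chi_{m,n}\in\mathfrak{S}_{m+n}$ be the permutation $i\mapsto n+i$ $(1\le i\le m)$, $m+j\mapsto j$ $(1\le j\le n)$, and let $\beta_{m,n}=\sigma_{i_1}\cdots\sigma_{i_l}$ on $V^{\otimes(m+n)}$ for a reduced expression $\chi_{m,n}=s_{i_1}\cdots s_{i_l}$ in the simple transpositions. Define $\sigma_{BT}$ on $\overline{\mathcal{Y}(V)}\otimes\overline{\mathcal{Y}(V)}$ by $$\sigma_{BT}\big(Y(v_1,\dots,v_m)\otimes Y'(v_{m+1},\dots,v_{m+n})\big)=(Y'\otimes Y)\,\beta_{m,n}(v_1\otimes\cdots\otimes v_{m+n}),$$ where on the right the first $n$ tensor factors decorate $Y'$ and the last $m$ decorate $Y$. **Theorem.** For every braided vector space $(V,\sigma)$,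 the quadruple $(\overline{\mathcal{Y}(V)},\prec_\sigma,\succ_\sigma,\sigma_{BT})$ together with $i_V: V\to\overline{\mathcal{Y}(V)}$, $v\mapsto Y[v]$, is the free braided dendriform algebra on $(V,\sigma)$. That is, $(\overline{\mathcal{Y}(V)},\prec_\sigma,\succ_\sigma,\sigma_{BT})$ is a braided dendriform algebra, $i_V$ is a homomorphism of braided vector spaces, and for every braided dendriform algebra $(D,\prec_D,\succ_D,\tau)$ and every homomorphism $\varphi: V\to D$ of braided vector spaces there is a unique homomorphism $\bar\varphi:\overline{\mathcal{Y}(V)}\to D$ of braided dendriform algebras with $\varphi=\bar\varphi\circ i_V$. -/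

import Mathlib

open scoped TensorProduct DirectSum

noncomputable section

namespace BraidedDend

/-! ### Braided vector spaces and braided dendriform algebras -/

section Braided

variable {k : Type*} [Field k] {D : Type*} [AddCommGroup D] [Module k D]

/-- `σ₁ = σ ⊗ id` on `D ⊗ D ⊗ D`. -/
def sigmaOne (σ : D ⊗[k] D →ₗ[k] D ⊗[k] D) : (D ⊗[k] D) ⊗[k] D →ₗ[k] (D ⊗[k] D) ⊗[k] D :=
  σ.rTensor D

/-- `σ₂ = id ⊗ σ` on `D ⊗ D ⊗ D`. -/
def sigmaTwo (σ : D ⊗[k] D →ₗ[k] D ⊗[k] D) : (D ⊗[k] D) ⊗[k] D →ₗ[k] (D ⊗[k] D) ⊗[k] D :=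
  (TensorProduct.assoc k D D D).symm.toLinearMap ∘ₗ σ.lTensor D ∘ₗ
    (TensorProduct.assoc k D D D).toLinearMap

/-- `p ⊗ id : D ⊗ D ⊗ D → D ⊗ D` for a binary operation `p`. -/
def opTensorId (p : D ⊗[k] D →ₗ[k] D) : (D ⊗[k] D) ⊗[k] D →ₗ[k] D ⊗[k] D :=
  p.rTensor D

/-- `id ⊗ p : D ⊗ D ⊗ D → D ⊗ D` for a binary operation `p`. -/
def idTensorOp (p : D ⊗[k] D →ₗ[k] D) : (D ⊗[k] D) ⊗[k] D →ₗ[k] D ⊗[k] D :=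
  p.lTensor D ∘ₗ (TensorProduct.assoc k D D D).toLinearMap

/-- A braiding (Yang–Baxter operator): a linear endomorphism of `D ⊗ D` satisfying the braid
relation. Invertibility is not required. -/
def IsBraiding (σ : D ⊗[k] D →ₗ[k] D ⊗[k] D) : Prop :=
  sigmaOne σ ∘ₗ sigmaTwo σ ∘ₗ sigmaOne σ = sigmaTwo σ ∘ₗ sigmaOne σ ∘ₗ sigmaTwo σ

/-- A dendriform algebra `(D, ≺, ≻)`; the bilinear operations are given as maps on `D ⊗ D`. -/
structure IsDendriform (prec succ : D ⊗[k] D →ₗ[k] D) : Prop where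
  prec_prec : ∀ x y z : D,
    prec (prec (x ⊗ₜ y) ⊗ₜ z) = prec (x ⊗ₜ (prec (y ⊗ₜ z) + succ (y ⊗ₜ z)))
  succ_prec : ∀ x y z : D,
    prec (succ (x ⊗ₜ y) ⊗ₜ z) = succ (x ⊗ₜ prec (y ⊗ₜ z))
  succ_succ : ∀ x y z : D,
    succ ((prec (x ⊗ₜ y) + succ (x ⊗ₜ y)) ⊗ₜ z) = succ (x ⊗ₜ succ (y ⊗ₜ z))

/-- A braiding `σ` is compatible with a binary operation `p`:
`σ (id ⊗ p) = (p ⊗ id) σ₂ σ₁` and `σ (p ⊗ id) = (id ⊗ p) σ₁ σ₂`. -/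
structure IsCompatible (p : D ⊗[k] D →ₗ[k] D) (σ : D ⊗[k] D →ₗ[k] D ⊗[k] D) : Prop where
  id_op : σ ∘ₗ idTensorOp p = opTensorId p ∘ₗ sigmaTwo σ ∘ₗ sigmaOne σ
  op_id : σ ∘ₗ opTensorId p = idTensorOp p ∘ₗ sigmaOne σ ∘ₗ sigmaTwo σ

/-- A braided dendriform algebra `(D, ≺, ≻, σ)`. -/
structure IsBraidedDendriform (prec succ : D ⊗[k] D →ₗ[k] D)
    (σ : D ⊗[k] D →ₗ[k] D ⊗[k] D) : Prop where
  braiding : IsBraiding σ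
  dendriform : IsDendriform prec succ
  compat_prec : IsCompatible prec σ
  compat_succ : IsCompatible succ σ

variable {E : Type*} [AddCommGroup E] [Module k E]

/-- Homomorphisms of braided vector spaces: linear maps with `(f ⊗ f) σ = σ' (f ⊗ f)`. -/
def IsBraidedHom (σ : D ⊗[k] D →ₗ[k] D ⊗[k] D) (σ' : E ⊗[k] E →ₗ[k] E ⊗[k] E)
    (f : D →ₗ[k] E) : Prop :=
  TensorProduct.map f f ∘ₗ σ = σ' ∘ₗ TensorProduct.map f f

/-- Homomorphisms of braided dendriform algebras. -/
structure IsBraidedDendriformHom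
    (prec succ : D ⊗[k] D →ₗ[k] D) (σ : D ⊗[k] D →ₗ[k] D ⊗[k] D)
    (prec' succ' : E ⊗[k] E →ₗ[k] E) (σ' : E ⊗[k] E →ₗ[k] E ⊗[k] E)
    (f : D →ₗ[k] E) : Prop where
  map_prec : f ∘ₗ prec = prec' ∘ₗ TensorProduct.map f f
  map_succ : f ∘ₗ succ = succ' ∘ₗ TensorProduct.map f f
  braided : IsBraidedHom σ σ' f

end Braided

/-! ### The lift of a permutation to tensor powers -/

section Lift

variable {k : Type*} [Field k] {V : Type*} [AddCommGroup V] [Module k V]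

/-- `V ⊗ V ≃ V^{⊗2}`. -/
def tensorTwo : V ⊗[k] V ≃ₗ[k] ⨂[k]^(1 + 1) V :=
  (TensorProduct.congr (PiTensorProduct.subsingletonEquiv (0 : Fin 1)).symm
    (PiTensorProduct.subsingletonEquiv (0 : Fin 1)).symm).trans TensorPower.mulEquiv

/-- `V^{⊗n} ≃ V^{⊗i} ⊗ ((V ⊗ V) ⊗ V^{⊗(n-i-2)})`, singling out the factors in the positions
`i` and `i + 1` (positions are counted from `0`). -/
def isolatePair {n i : ℕ} (h : i + 2 ≤ n) :
    ⨂[k]^n V ≃ₗ[k] ⨂[k]^i V ⊗[k] ((V ⊗[k] V) ⊗[k] ⨂[k]^(n - i - 2) V) :=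
  (TensorPower.cast k V (show n = i + ((1 + 1) + (n - i - 2)) by omega)).trans
    (TensorPower.mulEquiv.symm.trans
      (TensorProduct.congr (LinearEquiv.refl k _)
        (TensorPower.mulEquiv.symm.trans
          (TensorProduct.congr tensorTwo.symm (LinearEquiv.refl k _)))))

/-- `σ` acting on the factors `i` and `i + 1` of `V^{⊗n}` (counted from `0`), that is
`id^{⊗i} ⊗ σ ⊗ id^{⊗(n-i-2)}`. Only used for `i + 2 ≤ n`. -/
def sigmaAt (σ : V ⊗[k] V →ₗ[k] V ⊗[k] V) (n i : ℕ) : Module.End k (⨂[k]^n V) :=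
  if h : i + 2 ≤ n then
    (isolatePair h).symm.toLinearMap ∘ₗ
      (σ.rTensor (⨂[k]^(n - i - 2) V)).lTensor (⨂[k]^i V) ∘ₗ (isolatePair h).toLinearMap
  else LinearMap.id

/-- The operator `σ_{i₁} ∘ ⋯ ∘ σ_{iₗ}` on `V^{⊗n}` attached to a word `[i₁, …, iₗ]`. -/
def wordOp (σ : V ⊗[k] V →ₗ[k] V ⊗[k] V) (n : ℕ) (L : List ℕ) : Module.End k (⨂[k]^n V) :=
  (L.map (sigmaAt σ n)).prod

/-- The permutation `s_{i₁} ⋯ s_{iₗ}` attached to a word `[i₁, …, iₗ]`, where `s_i` exchanges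
`i` and `i + 1`. -/
def wordPerm (L : List ℕ) : Equiv.Perm ℕ :=
  (L.map fun i => Equiv.swap i (i + 1)).prod

/-- A reduced expression of the block permutation `χ_{m,n}`, which sends the first `m` of `m + n`
places, in order, to the last `m`, and the last `n` to the first `n`; see `wordPerm_chiWord` and
`length_chiWord_le`. -/
def chiWord (m n : ℕ) : List ℕ :=
  (List.range m).flatMap fun r => (List.range n).reverse.map fun s => r + s

theorem wordPerm_shiftWord (r n x : ℕ) :
    wordPerm ((List.range n).reverse.map fun s => r + s) x =
      if x = r then r + n else if r < x ∧ x ≤ r + n then x - 1 else x := by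
  induction n generalizing x with
  | zero =>
    simp only [wordPerm, List.range_zero, List.reverse_nil, List.map_nil, List.prod_nil,
      Equiv.Perm.one_apply]
    split_ifs <;> omega
  | succ n ih =>
    have h : wordPerm ((List.range (n + 1)).reverse.map fun s => r + s) =
        Equiv.swap (r + n) (r + n + 1) *
          wordPerm ((List.range n).reverse.map fun s => r + s) := by
      simp [wordPerm, List.range_succ]
    rw [h, Equiv.Perm.mul_apply, ih, Equiv.swap_apply_def]
    split_ifs <;> omega

/-- The word `chiWord m n` represents the block permutation `χ_{m,n}`. -/
theorem wordPerm_chiWord (m n x : ℕ) :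
    wordPerm (chiWord m n) x =
      if x < m then x + n else if x < m + n then x - m else x := by
  induction m generalizing x with
  | zero => simp [wordPerm, chiWord]
  | succ m ih =>
    have h : wordPerm (chiWord (m + 1) n) = wordPerm (chiWord m n) *
        wordPerm ((List.range n).reverse.map fun s => m + s) := by
      simp [wordPerm, chiWord, List.range_succ]
    rw [h, Equiv.Perm.mul_apply, wordPerm_shiftWord, ih]
    split_ifs <;> omega

/-- The total displacement of the first `N` places grows by at most `2` per letter. -/
theorem sum_dist_wordPerm_le (N : ℕ) (L : List ℕ) :
    ∑ x ∈ Finset.range N, Nat.dist (wordPerm L x) x ≤ 2 * L.length := by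
  induction L with
  | nil => simp [wordPerm]
  | cons i L ih =>
    have h : wordPerm (i :: L) = Equiv.swap i (i + 1) * wordPerm L := by simp [wordPerm]
    have h1 : ∀ x, Nat.dist (wordPerm (i :: L) x) x ≤ Nat.dist (wordPerm L x) x +
        ((if wordPerm L x = i then 1 else 0) + (if wordPerm L x = i + 1 then 1 else 0)) := by
      intro x
      rw [h, Equiv.Perm.mul_apply, Equiv.swap_apply_def]
      unfold Nat.dist
      split_ifs <;> omega
    have h2 : ∀ j, ∑ x ∈ Finset.range N, (if wordPerm L x = j then 1 else 0) ≤ 1 := by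
      intro j
      rw [← Finset.card_filter, Finset.card_le_one]
      intro a ha b hb
      simp only [Finset.mem_filter] at ha hb
      exact (wordPerm L).injective (ha.2.trans hb.2.symm)
    have h3 := Finset.sum_le_sum fun x (_ : x ∈ Finset.range N) => h1 x
    rw [Finset.sum_add_distrib, Finset.sum_add_distrib] at h3
    have h4 := h2 i
    have h5 := h2 (i + 1)
    simp only [List.length_cons]
    omega

/-- The word `chiWord m n` is a shortest word for the permutation it represents. -/
theorem length_chiWord_le (m n : ℕ) (L : List ℕ) (hL : wordPerm L = wordPerm (chiWord m n)) :
    (chiWord m n).length ≤ L.length := by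
  have h := sum_dist_wordPerm_le (m + n) L
  rw [hL, Finset.sum_range_add] at h
  have h1 : ∑ x ∈ Finset.range m, Nat.dist (wordPerm (chiWord m n) x) x = m * n := by
    rw [Finset.sum_congr rfl (g := fun _ => n)]
    · simp
    · intro x hx
      rw [wordPerm_chiWord, if_pos (Finset.mem_range.1 hx)]
      unfold Nat.dist
      omega
  have h2 : ∑ x ∈ Finset.range n, Nat.dist (wordPerm (chiWord m n) (m + x)) (m + x) = n * m := by
    rw [Finset.sum_congr rfl (g := fun _ => m)]
    · simp
    · intro x hx
      have := Finset.mem_range.1 hx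
      rw [wordPerm_chiWord, if_neg (by omega), if_pos (by omega)]
      unfold Nat.dist
      omega
  have h3 : (chiWord m n).length = m * n := by
    simp [chiWord]
  rw [h1, h2, Nat.mul_comm n m] at h
  omega

/-- `β_{m,n}`, the lift of `χ_{m,n}` to `V^{⊗(m+n)}`. -/
def beta (σ : V ⊗[k] V →ₗ[k] V ⊗[k] V) (m n : ℕ) : Module.End k (⨂[k]^(m + n) V) :=
  wordOp σ (m + n) (chiWord m n)

end Lift

/-! ### Decorated planar binary trees -/

section Trees

/-- Planar binary trees; `numNodes` counts the internal vertices and `BinaryTree.nil` is `|`. -/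
abbrev Shape : Type := BinaryTree Unit

/-- Planar binary trees other than `|`. -/
abbrev Shape' : Type := {t : Shape // t ≠ BinaryTree.nil}

variable (k : Type*) [Field k] (V : Type*) [AddCommGroup V] [Module k V]

/-- `𝒴(V) = ⨁ₙ k𝓑ₙ ⊗ V^{⊗n}`, written as the direct sum over all planar binary trees `Y` of
`V^{⊗n}`, `n` being the number of internal vertices of `Y`. The element `v₁ ⊗ ⋯ ⊗ vₙ` of the
summand of `Y` is the decorated tree `Y(v₁, …, vₙ)`, the vertices being ordered from left to
right (in-order). -/
abbrev TreeMod : Type _ := ⨁ t : Shape, ⨂[k]^t.numNodes V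

/-- The part of `𝒴(V)` of positive degree: the direct sum over the trees other than `|`. -/
abbrev TreeMod' : Type _ := ⨁ t : Shape', ⨂[k]^t.1.numNodes V

variable {k V}

/-- The decorated tree(s) of shape `t` given by a tensor. -/
def deco (t : Shape) : ⨂[k]^t.numNodes V →ₗ[k] TreeMod k V :=
  DirectSum.lof k Shape (fun t : Shape => ⨂[k]^t.numNodes V) t

/-- The decorated tree(s) of shape `t ≠ |` given by a tensor. -/
def deco' (t : Shape') : ⨂[k]^t.1.numNodes V →ₗ[k] TreeMod' k V :=
  DirectSum.lof k Shape' (fun t : Shape' => ⨂[k]^t.1.numNodes V) t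

/-- The inclusion of the positive degree part in `𝒴(V)`. -/
def incl : TreeMod' k V →ₗ[k] TreeMod k V :=
  DirectSum.toModule k Shape' (TreeMod k V) fun t => deco t.1

/-- The tree `|`. -/
def leaf : TreeMod k V := deco BinaryTree.nil (PiTensorProduct.tprod k Fin.elim0)

/-- The tree with left branch `l` and right branch `r`. -/
abbrev join (l r : Shape) : Shape' := ⟨BinaryTree.node () l r, by simp⟩

/-- A linear map on a tensor product of direct sums from its restrictions to the summands. -/
def sumTensorLift {ι κ : Type*} [DecidableEq ι] [DecidableEq κ] {M : ι → Type*} {P : κ → Type*}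
    [∀ i, AddCommMonoid (M i)] [∀ i, Module k (M i)]
    [∀ j, AddCommMonoid (P j)] [∀ j, Module k (P j)] {N : Type*} [AddCommMonoid N] [Module k N]
    (B : ∀ i j, M i ⊗[k] P j →ₗ[k] N) : (⨁ i, M i) ⊗[k] (⨁ j, P j) →ₗ[k] N :=
  TensorProduct.lift
    (DirectSum.toModule k ι ((⨁ j, P j) →ₗ[k] N) fun i =>
      (DirectSum.toModule k κ (M i →ₗ[k] N) fun j => (TensorProduct.curry (B i j)).flip).flip)

/-- Decorations of a tree `l ∨_u r`: those of `l`, then `u`, then those of `r`. -/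
def nodeEquiv (l r : Shape) : ⨂[k]^l.numNodes V ⊗[k] (V ⊗[k] ⨂[k]^r.numNodes V) ≃ₗ[k]
    ⨂[k]^(BinaryTree.node () l r).numNodes V :=
  (TensorProduct.congr (LinearEquiv.refl k _)
    ((TensorProduct.congr (PiTensorProduct.subsingletonEquiv (0 : Fin 1)).symm
      (LinearEquiv.refl k _)).trans TensorPower.mulEquiv)).trans
    (TensorPower.mulEquiv.trans (TensorPower.cast k V (by simp only [BinaryTree.numNodes]; omega)))

/-- The grafting on the decorations of two fixed shapes, with the decoration of the root last. -/
def graftAt (l r : Shape) :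
    (⨂[k]^l.numNodes V ⊗[k] ⨂[k]^r.numNodes V) ⊗[k] V →ₗ[k] TreeMod' k V :=
  deco' (join l r) ∘ₗ (nodeEquiv l r).toLinearMap ∘ₗ
    (TensorProduct.comm k (⨂[k]^r.numNodes V) V).toLinearMap.lTensor (⨂[k]^l.numNodes V) ∘ₗ
    (TensorProduct.assoc k (⨂[k]^l.numNodes V) (⨂[k]^r.numNodes V) V).toLinearMap

/-- The grafting `∨ : 𝒴(V) ⊗ V ⊗ 𝒴(V) → 𝒴(V)`, whose values have positive degree. -/
def graft : TreeMod k V ⊗[k] (V ⊗[k] TreeMod k V) →ₗ[k] TreeMod' k V :=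
  TensorProduct.lift (sumTensorLift fun l r : Shape => TensorProduct.curry (graftAt l r)) ∘ₗ
    (TensorProduct.assoc k (TreeMod k V) (TreeMod k V) V).symm.toLinearMap ∘ₗ
    (TensorProduct.comm k V (TreeMod k V)).toLinearMap.lTensor (TreeMod k V)

/-- `(Y₁ ∨_u Y₂) ⊗ Y' ↦ Y₁ ∨_u (Y₂ * Y')` on decorations of fixed shapes, `S` being the product
`*` on the decorations of `Y₂` and `Y'`. -/
def precStep (l r t : Shape)
    (S : ⨂[k]^r.numNodes V ⊗[k] ⨂[k]^t.numNodes V →ₗ[k] TreeMod k V) :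
    ⨂[k]^(BinaryTree.node () l r).numNodes V ⊗[k] ⨂[k]^t.numNodes V →ₗ[k] TreeMod' k V :=
  graft ∘ₗ TensorProduct.map (deco l) (S.lTensor V) ∘ₗ
    ((TensorProduct.assoc k V (⨂[k]^r.numNodes V) (⨂[k]^t.numNodes V)).toLinearMap.lTensor
      (⨂[k]^l.numNodes V)) ∘ₗ
    (TensorProduct.assoc k (⨂[k]^l.numNodes V) (V ⊗[k] ⨂[k]^r.numNodes V)
      (⨂[k]^t.numNodes V)).toLinearMap ∘ₗ
    (nodeEquiv l r).symm.toLinearMap.rTensor (⨂[k]^t.numNodes V)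

/-- `Y ⊗ (Y₁' ∨_v Y₂') ↦ (Y * Y₁') ∨_v Y₂'` on decorations of fixed shapes, `S` being the product
`*` on the decorations of `Y` and `Y₁'`. -/
def succStep (s l r : Shape)
    (S : ⨂[k]^s.numNodes V ⊗[k] ⨂[k]^l.numNodes V →ₗ[k] TreeMod k V) :
    ⨂[k]^s.numNodes V ⊗[k] ⨂[k]^(BinaryTree.node () l r).numNodes V →ₗ[k] TreeMod' k V :=
  graft ∘ₗ TensorProduct.map S ((deco r).lTensor V) ∘ₗ
    (TensorProduct.assoc k (⨂[k]^s.numNodes V) (⨂[k]^l.numNodes V)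
      (V ⊗[k] ⨂[k]^r.numNodes V)).symm.toLinearMap ∘ₗ
    (nodeEquiv l r).symm.toLinearMap.lTensor (⨂[k]^s.numNodes V)

/-- `| * Y' = Y'` on decorations. -/
def starLeft (t : Shape) : ⨂[k]^0 V ⊗[k] ⨂[k]^t.numNodes V →ₗ[k] TreeMod k V :=
  deco t ∘ₗ (TensorProduct.lid k (⨂[k]^t.numNodes V)).toLinearMap ∘ₗ
    (PiTensorProduct.isEmptyEquiv (Fin 0)).toLinearMap.rTensor (⨂[k]^t.numNodes V)

/-- `Y * | = Y` on decorations. -/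
def starRight (s : Shape) : ⨂[k]^s.numNodes V ⊗[k] ⨂[k]^0 V →ₗ[k] TreeMod k V :=
  deco s ∘ₗ (TensorProduct.rid k (⨂[k]^s.numNodes V)).toLinearMap ∘ₗ
    (PiTensorProduct.isEmptyEquiv (Fin 0)).toLinearMap.lTensor (⨂[k]^s.numNodes V)

/-- The product `*` on decorations of fixed shapes: `|` is the unit, and `* = ≺ + ≻` otherwise. -/
def starAt : (s t : Shape) → ⨂[k]^s.numNodes V ⊗[k] ⨂[k]^t.numNodes V →ₗ[k] TreeMod k V
  | .nil, t => starLeft t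
  | .node () l r, .nil => starRight (.node () l r)
  | .node () l r, .node () l' r' =>
      incl ∘ₗ (precStep l r (.node () l' r') (starAt r (.node () l' r')) +
        succStep (.node () l r) l' r' (starAt (.node () l r) l'))
termination_by s t => s.numNodes + t.numNodes
decreasing_by all_goals simp only [BinaryTree.numNodes]; omega

/-- `≺` on decorations of fixed shapes: `(Y₁ ∨_u Y₂) ≺ Y' = Y₁ ∨_u (Y₂ * Y')`. -/
def precAt : (s t : Shape') → ⨂[k]^s.1.numNodes V ⊗[k] ⨂[k]^t.1.numNodes V →ₗ[k] TreeMod' k V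
  | ⟨.nil, h⟩, _ => absurd rfl h
  | ⟨.node () l r, _⟩, t => precStep l r t.1 (starAt r t.1)

/-- `≻` on decorations of fixed shapes: `Y ≻ (Y₁' ∨_v Y₂') = (Y * Y₁') ∨_v Y₂'`. -/
def succAt : (s t : Shape') → ⨂[k]^s.1.numNodes V ⊗[k] ⨂[k]^t.1.numNodes V →ₗ[k] TreeMod' k V
  | _, ⟨.nil, h⟩ => absurd rfl h
  | s, ⟨.node () l r, _⟩ => succStep s.1 l r (starAt s.1 l)

variable (k V)

/-- The operation `≺` on the positive degree part of `𝒴(V)`. -/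
def treePrec : TreeMod' k V ⊗[k] TreeMod' k V →ₗ[k] TreeMod' k V :=
  sumTensorLift precAt

/-- The operation `≻` on the positive degree part of `𝒴(V)`. -/
def treeSucc : TreeMod' k V ⊗[k] TreeMod' k V →ₗ[k] TreeMod' k V :=
  sumTensorLift succAt

/-- `v ↦ Y[v] = | ∨_v |`, the tree with one internal vertex, decorated by `v`. -/
def treeOne : V →ₗ[k] TreeMod' k V :=
  graft ∘ₗ TensorProduct.mk k (TreeMod k V) (V ⊗[k] TreeMod k V) leaf ∘ₗ
    (TensorProduct.mk k V (TreeMod k V)).flip leaf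

variable {k V}

/-- The braiding `σ_BT`: `Y(v₁, …, vₘ) ⊗ Y'(vₘ₊₁, …, vₘ₊ₙ)` is sent to
`(Y' ⊗ Y) β_{m,n}(v₁ ⊗ ⋯ ⊗ vₘ₊ₙ)`, where the first `n` factors decorate `Y'` and the last `m`
decorate `Y`. -/
def treeBraiding (σ : V ⊗[k] V →ₗ[k] V ⊗[k] V) :
    TreeMod' k V ⊗[k] TreeMod' k V →ₗ[k] TreeMod' k V ⊗[k] TreeMod' k V :=
  sumTensorLift fun s t : Shape' =>
    TensorProduct.map (deco' t) (deco' s) ∘ₗ TensorPower.mulEquiv.symm.toLinearMap ∘ₗ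
      (TensorPower.cast k V (Nat.add_comm s.1.numNodes t.1.numNodes)).toLinearMap ∘ₗ
      beta σ s.1.numNodes t.1.numNodes ∘ₗ TensorPower.mulEquiv.toLinearMap

end Trees

end BraidedDend

end

/-! A decorated tree is a shape together with the word of its decorations, read in in-order. Both
`≺` and `≻` concatenate words, since every vertex of the left argument precedes every vertex of the
right one, and they combine shapes independently of the decorations. Hence the trees decorated by
`V` embed in `S ⊗ T(V)`, where `S` is the algebra of trees decorated by scalars (its basis is the
set of shapes) and `T(V)` is the tensor algebra. Under this embedding `shapeWord`, each operation is
the one of `S` tensored with concatenation, and `σ_BT` is the flip of `S` combined with the block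
braiding of `T(V)`.

The axioms for `σ_BT` thus reduce to `T(V)`. The Yang–Baxter equation there says that a block
crossing slides through a third block (`block_yangBaxter`). Compatibility with concatenation says
that crossing a product means crossing its factors in turn (`block_add_left`, `block_add_right`).
These are identities between products of the `σ_i`, derived from distant commutation and the braid
relation. They pass to trees by pullback along the injective `shapeWord`.

For the universal property, `X ∨_v Z = (X ≻ Y[v]) ≺ Z`, with a factor omitted when it is `|`. So the
trees `Y[v]` generate, a homomorphism is determined by its values on them, and the formula dictates
the extension `fold`. It preserves both operations by induction on the number of vertices, using the
dendriform axioms of the target (`fold_deco`). It respects the braidings because compatibility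
computes the braiding of a product from those of its factors, so agreement on generators suffices
(`IsGenerated.isBraidedHom`). The map `shapeWord` is itself an instance of `fold`, hence a
dendriform homomorphism by construction. -/

open scoped TensorProduct DirectSum

noncomputable section

namespace BraidedDend

/-! ### Block braids in a monoid -/

section Words

variable {M : Type*} [Monoid M] (s : ℕ → M)

/-- The product `s_{a+n-1} ⋯ s_a`: one strand in position `a` passing `n` strands. -/
def strand (a n : ℕ) : M := ((List.range n).reverse.map fun t => s (a + t)).prod

/-- The block braid at offset `a`: `m` strands passing `n` strands. -/
def block (a m n : ℕ) : M := ((chiWord m n).map fun i => s (a + i)).prod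

@[simp] theorem strand_zero (a : ℕ) : strand s a 0 = 1 := by simp [strand]

theorem strand_succ (a n : ℕ) : strand s a (n + 1) = s (a + n) * strand s a n := by
  simp [strand, List.range_succ]

@[simp] theorem block_zero (a n : ℕ) : block s a 0 n = 1 := by simp [block, chiWord]

theorem block_succ (a m n : ℕ) : block s a (m + 1) n = block s a m n * strand s (a + m) n := by
  simp [block, strand, chiWord, List.range_succ, Function.comp_def, add_assoc]

theorem block_one (a n : ℕ) : block s a 1 n = strand s a n := by simp [block_succ s a 0 n]

theorem block_add_left (a m m' n : ℕ) :
    block s a (m + m') n = block s a m n * block s (a + m) m' n := by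
  induction m' with
  | zero => simp
  | succ m' ih => rw [← add_assoc, block_succ, ih, block_succ, mul_assoc, add_assoc]

theorem strand_add (a n n' : ℕ) : strand s a (n + n') = strand s (a + n) n' * strand s a n := by
  induction n' with
  | zero => simp
  | succ n' ih => rw [← add_assoc, strand_succ, ih, strand_succ, mul_assoc, add_assoc]

theorem mem_chiWord {m n i : ℕ} (h : i ∈ chiWord m n) : i + 2 ≤ m + n := by
  simp only [chiWord, List.mem_flatMap, List.mem_range, List.mem_map, List.mem_reverse] at h
  omega

variable {s}

theorem commute_strand {x : M} {a n : ℕ} (h : ∀ i < n, Commute x (s (a + i))) :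
    Commute x (strand s a n) := by
  refine Commute.list_prod_right _ _ fun y hy => ?_
  simp only [List.mem_map, List.mem_reverse, List.mem_range] at hy
  obtain ⟨i, hi, rfl⟩ := hy
  exact h i hi

theorem commute_block {x : M} {a m n : ℕ} (h : ∀ i, i + 2 ≤ m + n → Commute x (s (a + i))) :
    Commute x (block s a m n) := by
  refine Commute.list_prod_right _ _ fun y hy => ?_
  simp only [List.mem_map] at hy
  obtain ⟨i, hi, rfl⟩ := hy
  exact h i (mem_chiWord hi)

/-- Each strand of the block passes all `n + n'` strands at once on the left, but in two stages on
the right. Regrouping moves the second stage of the last strand past the first stage of the earlier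
ones; the letters involved are at distance at least two. -/
theorem block_add_right (hc : ∀ i j, i + 2 ≤ j → Commute (s i) (s j))
    (a m n n' : ℕ) :
    block s a m (n + n') = block s (a + n) m n' * block s a m n := by
  induction m with
  | zero => simp
  | succ m ih =>
    have h : Commute (block s a m n) (strand s (a + m + n) n') :=
      commute_strand fun i _ => (commute_block fun j _ => (hc _ _ (by omega)).symm).symm
    rw [block_succ, ih, strand_add, block_succ, block_succ, mul_assoc,
      ← mul_assoc (block s a m n), h.eq, show a + n + m = a + m + n by omega]
    simp only [mul_assoc]

/-- Two neighbouring strands pass the same `p` strands, and a crossing between them may be made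
before or after. Each passed strand costs one braid relation. The bound `K` matters: in degree `N`,
`sigmaAt` is the identity beyond the last pair, so the braid relation is only available for `i + 3 ≤
N`, whereas distant commutation always holds. -/
theorem strand_strand_mul (hc : ∀ i j, i + 2 ≤ j → Commute (s i) (s j)) {K : ℕ}
    (hb : ∀ i, i + 3 ≤ K → s i * s (i + 1) * s i = s (i + 1) * s i * s (i + 1))
    (a p : ℕ) (hK : a + p + 2 ≤ K) :
    strand s a p * strand s (a + 1) p * s a = s (a + p) * (strand s a p * strand s (a + 1) p) := by
  induction p with
  | zero => simp
  | succ p ih =>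
    have h : Commute (s (a + p + 1)) (strand s a p) :=
      commute_strand fun i _ => (hc _ _ (by omega)).symm
    have h1 := ih (by omega)
    have h2 := hb (a + p) (by omega)
    have h3 : strand s a (p + 1) * strand s (a + 1) (p + 1) =
        s (a + p) * s (a + p + 1) * (strand s a p * strand s (a + 1) p) := by
      rw [strand_succ, strand_succ, show a + 1 + p = a + p + 1 by omega, mul_assoc,
        ← mul_assoc (strand s a p), ← h.eq]
      simp only [mul_assoc]
    rw [h3, mul_assoc, h1, ← mul_assoc, h2, ← add_assoc]
    simp only [mul_assoc]

/-- Only the strands `i` and `i + 1` of the block meet the crossing. The `r` strands to their right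
commute with it before it has moved, the `i` strands to their left after it has moved, and the
middle is `strand_strand_mul`. -/
theorem block_mul (hc : ∀ i j, i + 2 ≤ j → Commute (s i) (s j)) {K : ℕ}
    (hb : ∀ i, i + 3 ≤ K → s i * s (i + 1) * s i = s (i + 1) * s i * s (i + 1))
    (a N p i : ℕ) (hi : i + 2 ≤ N) (hK : a + N + p ≤ K) :
    block s a N p * s (a + i) = s (a + i + p) * block s a N p := by
  obtain ⟨r, rfl⟩ := Nat.exists_eq_add_of_le hi
  have h1 : Commute (block s (a + (i + 2)) r p) (s (a + i)) :=
    (commute_block fun j _ => hc _ _ (by omega)).symm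
  have h2 : Commute (block s a i p) (s (a + i + p)) :=
    (commute_block fun j _ => (hc _ _ (by omega)).symm).symm
  have h3 := strand_strand_mul hc hb (a + i) p (by omega)
  have h4 : block s a (i + 2) p =
      block s a i p * (strand s (a + i) p * strand s (a + i + 1) p) := by
    rw [show i + 2 = i + 1 + 1 by rfl, block_succ, block_succ, mul_assoc, add_assoc a i 1]
  rw [block_add_left, mul_assoc, h1.eq, h4, ← mul_assoc, mul_assoc (block s a i p), h3,
    ← mul_assoc, h2.eq]
  simp only [mul_assoc]

/-- By `block_add_left`, two of the three factors on either side merge into the block of `m + n`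
strands passing `p`. What remains is to slide the word of `χ_{m,n}` through that block, letter by
letter, which shifts its letters by `p`. -/
theorem block_yangBaxter (hc : ∀ i j, i + 2 ≤ j → Commute (s i) (s j)) {K : ℕ}
    (hb : ∀ i, i + 3 ≤ K → s i * s (i + 1) * s i = s (i + 1) * s i * s (i + 1))
    (m n p : ℕ) (hK : m + n + p ≤ K) :
    block s 0 n p * block s n m p * block s 0 m n =
      block s p m n * block s 0 m p * block s m n p := by
  have key : ∀ L : List ℕ, (∀ i ∈ L, i + 2 ≤ m + n) →
      block s 0 (m + n) p * (L.map fun i => s (0 + i)).prod =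
        (L.map fun i => s (p + i)).prod * block s 0 (m + n) p := by
    intro L
    induction L with
    | nil => simp
    | cons i L ih =>
      intro h
      have h1 := block_mul hc hb 0 (m + n) p i (h i (by simp)) (by omega)
      rw [List.map_cons, List.prod_cons, ← mul_assoc, h1, mul_assoc,
        ih fun j hj => h j (by simp [hj]), List.map_cons, List.prod_cons, mul_assoc,
        show 0 + i + p = p + i by omega]
  have h1 := block_add_left s 0 m n p
  have h2 := block_add_left s 0 n m p
  have h3 := key (chiWord m n) fun i hi => mem_chiWord hi
  simp only [zero_add] at h1 h2
  rw [← h2, mul_assoc, ← h1, add_comm n m]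
  exact h3

end Words

/-! ### The braiding of the tensor algebra -/

section SumTensor

variable {k : Type*} [Field k] {ι κ : Type*} [DecidableEq ι] [DecidableEq κ]
  {M : ι → Type*} {P : κ → Type*}
  [∀ i, AddCommMonoid (M i)] [∀ i, Module k (M i)]
  [∀ j, AddCommMonoid (P j)] [∀ j, Module k (P j)] {N : Type*} [AddCommMonoid N] [Module k N]

theorem sumTensorLift_lof (B : ∀ i j, M i ⊗[k] P j →ₗ[k] N) (i : ι) (j : κ) (x : M i) (y : P j) :
    sumTensorLift B (DirectSum.lof k ι M i x ⊗ₜ DirectSum.lof k κ P j y) = B i j (x ⊗ₜ y) := by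
  simp [sumTensorLift]

theorem directSum_tensor_ext {f g : (⨁ i, M i) ⊗[k] (⨁ j, P j) →ₗ[k] N}
    (h : ∀ i j (x : M i) (y : P j), f (DirectSum.lof k ι M i x ⊗ₜ DirectSum.lof k κ P j y) =
      g (DirectSum.lof k ι M i x ⊗ₜ DirectSum.lof k κ P j y)) : f = g := by
  refine TensorProduct.ext (DirectSum.linearMap_ext k fun i => LinearMap.ext fun x =>
    DirectSum.linearMap_ext k fun j => LinearMap.ext fun y => h i j x y)

end SumTensor

/-! ### The operators `σ_i` on the tensor algebra -/

section TensorAlg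

variable (k : Type*) [Field k] (V : Type*) [AddCommGroup V] [Module k V]

/-- The tensor algebra of `V`, as the direct sum of the tensor powers. -/
abbrev TAlg : Type _ := ⨁ n : ℕ, ⨂[k]^n V

variable {k V}

/-- The inclusion of a tensor power in the tensor algebra. -/
def pow (n : ℕ) : ⨂[k]^n V →ₗ[k] TAlg k V := DirectSum.lof k ℕ (fun n => ⨂[k]^n V) n

theorem pow_injective (n : ℕ) : Function.Injective (pow n : ⨂[k]^n V →ₗ[k] TAlg k V) :=
  DirectSum.of_injective (β := fun n => ⨂[k]^n V) n

/-- This is the purpose of working in the tensor algebra: transports between equal degrees disappear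
there, and `pow_injective` brings identities back to a fixed degree. -/
theorem pow_cast {m n : ℕ} (h : m = n) (x : ⨂[k]^m V) :
    pow n (TensorPower.cast k V h x) = pow m x := by
  subst h
  simp

theorem pow_mulEquiv {m n : ℕ} (x : ⨂[k]^m V) (y : ⨂[k]^n V) :
    pow (m + n) (TensorPower.mulEquiv (x ⊗ₜ[k] y)) = pow m x * pow n y :=
  (DirectSum.of_mul_of (A := fun n => ⨂[k]^n V) x y).symm

/-- The inclusion of `V` in the tensor algebra. -/
def gen : V →ₗ[k] TAlg k V :=
  pow 1 ∘ₗ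
    (PiTensorProduct.subsingletonEquiv (R := k) (s := fun _ => V) (0 : Fin 1)).symm.toLinearMap

theorem pow_zero_tprod : pow 0 (PiTensorProduct.tprod k Fin.elim0) = (1 : TAlg k V) := rfl

/-- The multiplication `V ⊗ V → T(V)`. -/
def genTwo : V ⊗[k] V →ₗ[k] TAlg k V := pow (1 + 1) ∘ₗ tensorTwo.toLinearMap

theorem genTwo_tmul (u v : V) : genTwo (u ⊗ₜ[k] v) = gen u * gen v := by
  simp only [genTwo, tensorTwo, gen, LinearMap.comp_apply, LinearEquiv.coe_coe,
    LinearEquiv.trans_apply, TensorProduct.congr_tmul, pow_mulEquiv]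

theorem pow_isolatePair_symm {n i : ℕ} (h : i + 2 ≤ n) (a : ⨂[k]^i V) (z : V ⊗[k] V)
    (b : ⨂[k]^(n - i - 2) V) :
    pow n ((isolatePair h).symm (a ⊗ₜ (z ⊗ₜ b))) = pow i a * (genTwo z * pow (n - i - 2) b) := by
  simp only [isolatePair, LinearEquiv.trans_symm, LinearEquiv.trans_apply,
    TensorPower.cast_symm, pow_cast, LinearEquiv.symm_symm, TensorProduct.congr_symm,
    TensorProduct.congr_tmul, pow_mulEquiv, LinearEquiv.refl_symm, LinearEquiv.refl_apply]
  rfl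

variable (σ : V ⊗[k] V →ₗ[k] V ⊗[k] V)

/-- `σ` acting on the factors `i` and `i + 1` in every degree. -/
def sigmaT (i : ℕ) : Module.End k (TAlg k V) := DirectSum.lmap fun n => sigmaAt σ n i

theorem sigmaT_pow (i n : ℕ) (x : ⨂[k]^n V) : sigmaT σ i (pow n x) = pow n (sigmaAt σ n i x) := by
  simp [sigmaT, pow]

theorem sigmaT_isolated (i j : ℕ) (a : ⨂[k]^i V) (z : V ⊗[k] V) (b : ⨂[k]^j V) :
    sigmaT σ i (pow i a * (genTwo z * pow j b)) = pow i a * (genTwo (σ z) * pow j b) := by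
  -- The isolated pair sits in total degree `n = i + 2 + j`, so that the tail has length `n - i - 2
  -- = j`.
  obtain ⟨n, h, rfl⟩ : ∃ n, i + 2 ≤ n ∧ j = n - i - 2 := ⟨i + 2 + j, by omega, by omega⟩
  rw [← pow_isolatePair_symm h, sigmaT_pow, sigmaAt, dif_pos h, ← pow_isolatePair_symm h]
  simp

theorem sigmaT_of_lt {i n : ℕ} (h : n < i + 2) (x : ⨂[k]^n V) :
    sigmaT σ i (pow n x) = pow n x := by
  rw [sigmaT_pow, sigmaAt, dif_neg (by omega)]
  rfl

/-- Elements of a tensor power are sums of tensors with an isolated pair of factors. -/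
theorem isolated_induction {n i : ℕ} (h : i + 2 ≤ n) {f g : TAlg k V →ₗ[k] TAlg k V}
    (H : ∀ (a : ⨂[k]^i V) (z : V ⊗[k] V) (b : ⨂[k]^(n - i - 2) V),
      f (pow i a * (genTwo z * pow _ b)) = g (pow i a * (genTwo z * pow _ b))) (x : ⨂[k]^n V) :
    f (pow n x) = g (pow n x) := by
  obtain ⟨w, rfl⟩ := (isolatePair h).symm.surjective x
  induction w using TensorProduct.induction_on with
  | zero => simp
  | add w w' h1 h2 => simp only [map_add, h1, h2]
  | tmul a w =>
    induction w using TensorProduct.induction_on with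
    | zero => simp
    | add w w' h1 h2 => simp only [TensorProduct.tmul_add, map_add, h1, h2]
    | tmul z b => rw [pow_isolatePair_symm]; exact H a z b

theorem exists_pow_mul {m n : ℕ} (x : ⨂[k]^m V) (y : ⨂[k]^n V) :
    ∃ z : ⨂[k]^(m + n) V, pow m x * pow n y = pow (m + n) z :=
  ⟨_, (pow_mulEquiv x y).symm⟩

theorem sigmaT_mul_left {i m n : ℕ} (h : i + 2 ≤ m) (x : ⨂[k]^m V) (y : ⨂[k]^n V) :
    sigmaT σ i (pow m x * pow n y) = sigmaT σ i (pow m x) * pow n y := by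
  refine isolated_induction h (f := sigmaT σ i ∘ₗ LinearMap.mulRight k (pow n y))
    (g := LinearMap.mulRight k (pow n y) ∘ₗ sigmaT σ i) (fun a z b => ?_) x
  obtain ⟨c, hc⟩ := exists_pow_mul b y
  simp only [LinearMap.comp_apply, LinearMap.mulRight_apply, sigmaT_isolated, mul_assoc, hc]

/-- No bound on `i` is needed here: when the pair overruns the right factor it also overruns the
product, and both operators are the identity by convention. -/
theorem sigmaT_mul_right (i m n : ℕ) (x : ⨂[k]^m V) (y : ⨂[k]^n V) :
    sigmaT σ (m + i) (pow m x * pow n y) = pow m x * sigmaT σ i (pow n y) := by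
  by_cases h : i + 2 ≤ n
  · refine isolated_induction h (f := sigmaT σ (m + i) ∘ₗ LinearMap.mulLeft k (pow m x))
      (g := LinearMap.mulLeft k (pow m x) ∘ₗ sigmaT σ i) (fun a z b => ?_) y
    obtain ⟨c, hc⟩ := exists_pow_mul x a
    simp only [LinearMap.comp_apply, LinearMap.mulLeft_apply, sigmaT_isolated]
    rw [← mul_assoc, hc, sigmaT_isolated, ← hc, mul_assoc]
  · obtain ⟨c, hc⟩ := exists_pow_mul x y
    rw [sigmaT_of_lt σ (by omega : n < i + 2), hc, sigmaT_of_lt σ (by omega)]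

/-- Elements of `V^{⊗(m+n)}` are sums of products. -/
theorem pow_add_induction {m n : ℕ} {f g : TAlg k V →ₗ[k] TAlg k V}
    (H : ∀ (a : ⨂[k]^m V) (b : ⨂[k]^n V), f (pow m a * pow n b) = g (pow m a * pow n b))
    (x : ⨂[k]^(m + n) V) : f (pow (m + n) x) = g (pow (m + n) x) := by
  obtain ⟨w, rfl⟩ := TensorPower.mulEquiv.surjective x
  induction w using TensorProduct.induction_on with
  | zero => simp
  | add w w' h1 h2 => simp only [map_add, h1, h2]
  | tmul a b => rw [pow_mulEquiv]; exact H a b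

/-- Cutting the word at position `j` puts the two operators on different factors: `σ_i` acts on the
left one and `σ_j` becomes `σ_0` on the right one. If the word is shorter than `j`, then `σ_j` is
the identity. -/
theorem sigmaT_comm {i j : ℕ} (h : i + 2 ≤ j) (n : ℕ) (x : ⨂[k]^n V) :
    sigmaT σ i (sigmaT σ j (pow n x)) = sigmaT σ j (sigmaT σ i (pow n x)) := by
  by_cases hj : j ≤ n
  · obtain ⟨r, rfl⟩ := Nat.exists_eq_add_of_le hj
    refine pow_add_induction (f := sigmaT σ i ∘ₗ sigmaT σ j) (g := sigmaT σ j ∘ₗ sigmaT σ i)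
      (fun a b => ?_) x
    have h1 := sigmaT_mul_right σ 0 j r a b
    have h2 := sigmaT_mul_right σ 0 j r (sigmaAt σ j i a) b
    simp only [add_zero] at h1 h2
    simp only [LinearMap.comp_apply]
    rw [h1, sigmaT_mul_left σ h, sigmaT_pow σ i, h2, sigmaT_pow σ 0, sigmaT_mul_left σ h,
      sigmaT_pow σ i]
  · rw [sigmaT_of_lt σ (by omega : n < j + 2), sigmaT_pow, sigmaT_of_lt σ (by omega)]

/-- The multiplication `V ⊗ V ⊗ V → T(V)`. -/
def genThree : (V ⊗[k] V) ⊗[k] V →ₗ[k] TAlg k V :=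
  LinearMap.mul' k (TAlg k V) ∘ₗ TensorProduct.map genTwo gen

/-- This lemma and the next match the operators in degree three with those in the definition of a
braiding, so that the hypothesis on `σ` can be used. -/
theorem sigmaT_zero_genThree (w : (V ⊗[k] V) ⊗[k] V) :
    sigmaT σ 0 (genThree w) = genThree (sigmaOne σ w) := by
  suffices h : sigmaT σ 0 ∘ₗ genThree = genThree ∘ₗ sigmaOne σ from LinearMap.congr_fun h w
  refine TensorProduct.ext' fun z v => ?_
  have h := sigmaT_isolated σ 0 1 (PiTensorProduct.tprod k Fin.elim0) z
    ((PiTensorProduct.subsingletonEquiv (0 : Fin 1)).symm v)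
  rw [pow_zero_tprod, one_mul, one_mul] at h
  simp only [LinearMap.comp_apply, genThree, TensorProduct.map_tmul, LinearMap.mul'_apply,
    sigmaOne, LinearMap.rTensor_tmul]
  exact h

theorem sigmaT_one_genThree (w : (V ⊗[k] V) ⊗[k] V) :
    sigmaT σ 1 (genThree w) = genThree (sigmaTwo σ w) := by
  have h1 : ∀ (u : V) (z : V ⊗[k] V),
      genThree ((TensorProduct.assoc k V V V).symm (u ⊗ₜ z)) = gen u * genTwo z := by
    intro u z
    induction z using TensorProduct.induction_on with
    | zero => simp
    | add w w' h1 h2 => simp only [TensorProduct.tmul_add, map_add, h1, h2, mul_add]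
    | tmul v w =>
      simp only [genThree, TensorProduct.assoc_symm_tmul, LinearMap.comp_apply,
        TensorProduct.map_tmul, LinearMap.mul'_apply, genTwo_tmul, mul_assoc]
  obtain ⟨w, rfl⟩ := (TensorProduct.assoc k V V V).symm.surjective w
  induction w using TensorProduct.induction_on with
  | zero => simp
  | add w w' h1 h2 => simp only [map_add, h1, h2]
  | tmul u z =>
    have h := sigmaT_isolated σ 1 0 ((PiTensorProduct.subsingletonEquiv (0 : Fin 1)).symm u) z
      (PiTensorProduct.tprod k Fin.elim0)
    rw [pow_zero_tprod, mul_one, mul_one] at h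
    simp only [sigmaTwo, LinearMap.comp_apply, LinearEquiv.coe_coe, LinearEquiv.apply_symm_apply,
      LinearMap.lTensor_tmul, h1]
    exact h

theorem exists_genThree (x : ⨂[k]^3 V) : ∃ w : (V ⊗[k] V) ⊗[k] V, pow 3 x = genThree w := by
  obtain ⟨w, rfl⟩ := (TensorPower.mulEquiv (n := 1 + 1) (m := 1)).surjective x
  refine ⟨TensorProduct.congr tensorTwo.symm
    (PiTensorProduct.subsingletonEquiv (0 : Fin 1)) w, ?_⟩
  induction w using TensorProduct.induction_on with
  | zero => simp
  | add w w' h1 h2 => simp only [map_add, h1, h2]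
  | tmul a b =>
    refine (pow_mulEquiv a b).trans ?_
    simp [genThree, genTwo, gen]

/-- The relation only involves three consecutive factors. Splitting off what lies beyond them, then
what lies before, leaves the case of degree three. -/
theorem sigmaT_braid (hσ : IsBraiding σ) {i n : ℕ} (h : i + 3 ≤ n) (x : ⨂[k]^n V) :
    sigmaT σ i (sigmaT σ (i + 1) (sigmaT σ i (pow n x))) =
      sigmaT σ (i + 1) (sigmaT σ i (sigmaT σ (i + 1) (pow n x))) := by
  have key : ∀ b : ⨂[k]^3 V, sigmaT σ 0 (sigmaT σ 1 (sigmaT σ 0 (pow 3 b))) =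
      sigmaT σ 1 (sigmaT σ 0 (sigmaT σ 1 (pow 3 b))) := by
    intro b
    obtain ⟨w, hw⟩ := exists_genThree b
    simp only [hw, sigmaT_zero_genThree, sigmaT_one_genThree]
    exact congrArg genThree (LinearMap.congr_fun hσ w)
  obtain ⟨r, rfl⟩ := Nat.exists_eq_add_of_le h
  refine pow_add_induction (f := sigmaT σ i ∘ₗ sigmaT σ (i + 1) ∘ₗ sigmaT σ i)
    (g := sigmaT σ (i + 1) ∘ₗ sigmaT σ i ∘ₗ sigmaT σ (i + 1)) (fun a c => ?_) x
  simp only [LinearMap.comp_apply]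
  simp only [sigmaT_mul_left σ (by omega : i + 2 ≤ i + 3),
    sigmaT_mul_left σ (by omega : i + 1 + 2 ≤ i + 3), sigmaT_pow]
  congr 1
  simp only [← sigmaT_pow]
  -- The tail is gone; now the first `i` factors are split off, which lowers the indices `i` and `i
  -- + 1` to `0` and `1`.
  refine pow_add_induction (f := sigmaT σ i ∘ₗ sigmaT σ (i + 1) ∘ₗ sigmaT σ i)
    (g := sigmaT σ (i + 1) ∘ₗ sigmaT σ i ∘ₗ sigmaT σ (i + 1)) (fun a b => ?_) a
  have h0 := fun b => sigmaT_mul_right σ 0 i 3 a b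
  have h1 := fun b => sigmaT_mul_right σ 1 i 3 a b
  simp only [LinearMap.comp_apply, add_zero] at h0 h1 ⊢
  have hb := key b
  simp only [sigmaT_pow] at h0 h1 hb
  simp only [h0, h1, hb]

end TensorAlg

/-! ### Block braidings of tensor powers -/

section TensorBraiding

variable {k : Type*} [Field k] {V : Type*} [AddCommGroup V] [Module k V]
variable (σ : V ⊗[k] V →ₗ[k] V ⊗[k] V)

theorem word_sigmaT_pow (N : ℕ) (L : List ℕ) (x : ⨂[k]^N V) :
    (L.map (sigmaT σ)).prod (pow N x) = pow N ((L.map (sigmaAt σ N)).prod x) := by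
  induction L with
  | nil => rfl
  | cons i L ih =>
    simp only [List.map_cons, List.prod_cons, Module.End.mul_apply, ih, sigmaT_pow]

theorem word_mul_left {m n : ℕ} (x : ⨂[k]^m V) (y : ⨂[k]^n V) (L : List ℕ)
    (hL : ∀ i ∈ L, i + 2 ≤ m) :
    (L.map (sigmaT σ)).prod (pow m x * pow n y) =
      (L.map (sigmaT σ)).prod (pow m x) * pow n y := by
  induction L with
  | nil => rfl
  | cons i L ih =>
    simp only [List.map_cons, List.prod_cons, Module.End.mul_apply,
      ih fun j hj => hL j (by simp [hj]), word_sigmaT_pow]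
    exact sigmaT_mul_left σ (hL i (by simp)) _ _

theorem word_mul_right {m n : ℕ} (x : ⨂[k]^m V) (y : ⨂[k]^n V) (L : List ℕ) :
    (L.map fun i => sigmaT σ (m + i)).prod (pow m x * pow n y) =
      pow m x * (L.map (sigmaT σ)).prod (pow n y) := by
  induction L with
  | nil => rfl
  | cons i L ih =>
    simp only [List.map_cons, List.prod_cons, Module.End.mul_apply, ih, word_sigmaT_pow]
    exact sigmaT_mul_right σ i m n _ _

theorem block_sigmaT_pow (N a m n : ℕ) (x : ⨂[k]^N V) :
    block (sigmaT σ) a m n (pow N x) = pow N (block (sigmaAt σ N) a m n x) := by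
  have h := word_sigmaT_pow σ N ((chiWord m n).map fun i => a + i) x
  rw [List.map_map, List.map_map] at h
  exact h

theorem block_zero_eq {M : Type*} [Monoid M] (s : ℕ → M) (m n : ℕ) :
    block s 0 m n = ((chiWord m n).map s).prod := by
  simp [block]

theorem block_mul_left {m n p : ℕ} (x : ⨂[k]^(m + n) V) (y : ⨂[k]^p V) :
    block (sigmaT σ) 0 m n (pow (m + n) x * pow p y) =
      block (sigmaT σ) 0 m n (pow (m + n) x) * pow p y := by
  rw [block_zero_eq]
  exact word_mul_left σ x y _ fun i hi => mem_chiWord hi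

theorem block_mul_right {m n a p : ℕ} (x : ⨂[k]^a V) (y : ⨂[k]^p V) :
    block (sigmaT σ) a m n (pow a x * pow p y) =
      pow a x * block (sigmaT σ) 0 m n (pow p y) := by
  rw [block_zero_eq]
  exact word_mul_right σ x y _

theorem commute_sigmaAt (N i j : ℕ) (h : i + 2 ≤ j) :
    Commute (sigmaAt σ N i) (sigmaAt σ N j) := by
  refine LinearMap.ext fun x => pow_injective N ?_
  have h1 := sigmaT_comm σ h N x
  simp only [sigmaT_pow] at h1
  exact h1

variable {σ} in
theorem sigmaAt_braid (hσ : IsBraiding σ) (N i : ℕ) (h : i + 3 ≤ N) :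
    sigmaAt σ N i * sigmaAt σ N (i + 1) * sigmaAt σ N i =
      sigmaAt σ N (i + 1) * sigmaAt σ N i * sigmaAt σ N (i + 1) := by
  refine LinearMap.ext fun x => pow_injective N ?_
  have h1 := sigmaT_braid σ hσ h x
  simp only [sigmaT_pow] at h1
  exact h1

/-- The block braiding `V^{⊗m} ⊗ V^{⊗n} → V^{⊗n} ⊗ V^{⊗m}`. -/
def braidAt (m n : ℕ) : ⨂[k]^m V ⊗[k] ⨂[k]^n V →ₗ[k] ⨂[k]^n V ⊗[k] ⨂[k]^m V :=
  TensorPower.mulEquiv.symm.toLinearMap ∘ₗ (TensorPower.cast k V (Nat.add_comm m n)).toLinearMap ∘ₗ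
    beta σ m n ∘ₗ TensorPower.mulEquiv.toLinearMap

variable (k V) in
/-- The multiplication `V^{⊗m} ⊗ V^{⊗n} → T(V)`. -/
def powTwo (m n : ℕ) : ⨂[k]^m V ⊗[k] ⨂[k]^n V →ₗ[k] TAlg k V :=
  pow (m + n) ∘ₗ TensorPower.mulEquiv.toLinearMap

theorem powTwo_tmul {m n : ℕ} (x : ⨂[k]^m V) (y : ⨂[k]^n V) :
    powTwo k V m n (x ⊗ₜ y) = pow m x * pow n y := pow_mulEquiv x y

theorem powTwo_injective (m n : ℕ) : Function.Injective (powTwo k V m n) :=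
  (pow_injective _).comp TensorPower.mulEquiv.injective

/-- Inside the tensor algebra the block braiding is just the operator `block`: the regrouping of
factors and the change from `m + n` to `n + m` become invisible. -/
theorem powTwo_braidAt (m n : ℕ) (w : ⨂[k]^m V ⊗[k] ⨂[k]^n V) :
    powTwo k V n m (braidAt σ m n w) = block (sigmaT σ) 0 m n (powTwo k V m n w) := by
  simp only [powTwo, braidAt, LinearMap.comp_apply, LinearEquiv.coe_coe,
    LinearEquiv.apply_symm_apply, pow_cast, block_zero_eq, word_sigmaT_pow]
  rfl

variable (k V) in
/-- The multiplication `V^{⊗a} ⊗ V^{⊗b} ⊗ V^{⊗c} → T(V)`. -/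
def powThree (a b c : ℕ) : (⨂[k]^a V ⊗[k] ⨂[k]^b V) ⊗[k] ⨂[k]^c V →ₗ[k] TAlg k V :=
  powTwo k V (a + b) c ∘ₗ TensorPower.mulEquiv.toLinearMap.rTensor _

theorem powThree_tmul {a b c : ℕ} (w : ⨂[k]^a V ⊗[k] ⨂[k]^b V) (z : ⨂[k]^c V) :
    powThree k V a b c (w ⊗ₜ z) = powTwo k V a b w * pow c z := by
  simp only [powThree, LinearMap.comp_apply, LinearMap.rTensor_tmul, powTwo_tmul]
  rfl

theorem powThree_assoc_symm {a b c : ℕ} (x : ⨂[k]^a V) (w : ⨂[k]^b V ⊗[k] ⨂[k]^c V) :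
    powThree k V a b c ((TensorProduct.assoc k _ _ _).symm (x ⊗ₜ w)) =
      pow a x * powTwo k V b c w := by
  induction w using TensorProduct.induction_on with
  | zero => simp
  | add w w' h1 h2 => simp only [TensorProduct.tmul_add, map_add, h1, h2, mul_add]
  | tmul y z =>
    rw [TensorProduct.assoc_symm_tmul, powThree_tmul, powTwo_tmul, powTwo_tmul, mul_assoc]

theorem powThree_injective (a b c : ℕ) : Function.Injective (powThree k V a b c) := by
  refine (powTwo_injective _ _).comp ?_
  exact (TensorProduct.congr TensorPower.mulEquiv (LinearEquiv.refl k (⨂[k]^c V))).injective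

theorem exists_powThree (a b c : ℕ) (w : (⨂[k]^a V ⊗[k] ⨂[k]^b V) ⊗[k] ⨂[k]^c V) :
    ∃ x : ⨂[k]^(a + b + c) V, powThree k V a b c w = pow _ x := ⟨_, rfl⟩

/-- The block braiding of the first two of three tensor powers. -/
def braidLeft (a b c : ℕ) : (⨂[k]^a V ⊗[k] ⨂[k]^b V) ⊗[k] ⨂[k]^c V →ₗ[k]
    (⨂[k]^b V ⊗[k] ⨂[k]^a V) ⊗[k] ⨂[k]^c V :=
  (braidAt σ a b).rTensor _

/-- The block braiding of the last two of three tensor powers. -/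
def braidRight (a b c : ℕ) : (⨂[k]^a V ⊗[k] ⨂[k]^b V) ⊗[k] ⨂[k]^c V →ₗ[k]
    (⨂[k]^a V ⊗[k] ⨂[k]^c V) ⊗[k] ⨂[k]^b V :=
  (TensorProduct.assoc k _ _ _).symm.toLinearMap ∘ₗ (braidAt σ b c).lTensor _ ∘ₗ
    (TensorProduct.assoc k _ _ _).toLinearMap

theorem powThree_braidLeft (a b c : ℕ) (w : (⨂[k]^a V ⊗[k] ⨂[k]^b V) ⊗[k] ⨂[k]^c V) :
    powThree k V b a c (braidLeft σ a b c w) =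
      block (sigmaT σ) 0 a b (powThree k V a b c w) := by
  induction w using TensorProduct.induction_on with
  | zero => simp
  | add w w' h1 h2 => simp only [map_add, h1, h2]
  | tmul w z =>
    rw [braidLeft, LinearMap.rTensor_tmul, powThree_tmul, powThree_tmul, powTwo_braidAt]
    exact (block_mul_left σ _ z).symm

theorem powThree_braidRight (a b c : ℕ) (w : (⨂[k]^a V ⊗[k] ⨂[k]^b V) ⊗[k] ⨂[k]^c V) :
    powThree k V a c b (braidRight σ a b c w) =
      block (sigmaT σ) a b c (powThree k V a b c w) := by
  obtain ⟨w, rfl⟩ := (TensorProduct.assoc k _ _ _).symm.surjective w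
  induction w using TensorProduct.induction_on with
  | zero => simp
  | add w w' h1 h2 => simp only [map_add, h1, h2]
  | tmul x w =>
    rw [braidRight, LinearMap.comp_apply, LinearMap.comp_apply, LinearEquiv.coe_coe,
      LinearEquiv.coe_coe, LinearEquiv.apply_symm_apply, LinearMap.lTensor_tmul,
      powThree_assoc_symm, powThree_assoc_symm, powTwo_braidAt]
    exact (block_mul_right σ x _).symm

-- Inside the tensor algebra, the braidings of the left and right pairs are `block` operators with
-- offsets zero and the length of the first factor, which turns the claim into `block_yangBaxter`.
variable {σ} in
theorem braidAt_yangBaxter (hσ : IsBraiding σ) (a b c : ℕ)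
    (w : (⨂[k]^a V ⊗[k] ⨂[k]^b V) ⊗[k] ⨂[k]^c V) :
    braidLeft σ b c a (braidRight σ b a c (braidLeft σ a b c w)) =
      braidRight σ c a b (braidLeft σ a c b (braidRight σ a b c w)) := by
  refine powThree_injective _ _ _ ?_
  simp only [powThree_braidLeft, powThree_braidRight]
  obtain ⟨x, hx⟩ := exists_powThree a b c w
  -- The monoid is that of endomorphisms of the single degree `a + b + c`, with `K = a + b + c`. On
  -- the whole tensor algebra the braid relation may fail in low degrees, where some of the
  -- operators are replaced by the identity.
  have h := LinearMap.congr_fun (block_yangBaxter (commute_sigmaAt σ (a + b + c))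
    (sigmaAt_braid hσ (a + b + c)) a b c le_rfl) x
  simp only [hx, block_sigmaT_pow]
  exact congrArg _ h

/-- The multiplication of the first two of three tensor powers. -/
def mulLeft (a b c : ℕ) : (⨂[k]^a V ⊗[k] ⨂[k]^b V) ⊗[k] ⨂[k]^c V →ₗ[k]
    ⨂[k]^(a + b) V ⊗[k] ⨂[k]^c V :=
  TensorPower.mulEquiv.toLinearMap.rTensor _

/-- The multiplication of the last two of three tensor powers. -/
def mulRight (a b c : ℕ) : (⨂[k]^a V ⊗[k] ⨂[k]^b V) ⊗[k] ⨂[k]^c V →ₗ[k]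
    ⨂[k]^a V ⊗[k] ⨂[k]^(b + c) V :=
  TensorPower.mulEquiv.toLinearMap.lTensor _ ∘ₗ (TensorProduct.assoc k _ _ _).toLinearMap

theorem powTwo_mulLeft (a b c : ℕ) (w : (⨂[k]^a V ⊗[k] ⨂[k]^b V) ⊗[k] ⨂[k]^c V) :
    powTwo k V (a + b) c (mulLeft a b c w) = powThree k V a b c w := rfl

theorem powTwo_mulRight (a b c : ℕ) (w : (⨂[k]^a V ⊗[k] ⨂[k]^b V) ⊗[k] ⨂[k]^c V) :
    powTwo k V a (b + c) (mulRight a b c w) = powThree k V a b c w := by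
  obtain ⟨w, rfl⟩ := (TensorProduct.assoc k _ _ _).symm.surjective w
  induction w using TensorProduct.induction_on with
  | zero => simp
  | add w w' h1 h2 => simp only [map_add, h1, h2]
  | tmul x w =>
    rw [mulRight, LinearMap.comp_apply, LinearEquiv.coe_coe, LinearEquiv.apply_symm_apply,
      LinearMap.lTensor_tmul, powThree_assoc_symm, powTwo_tmul]
    rfl

/-- This is `block_add_right` read on three tensor powers. Its mirror image below is
`block_add_left`, which only splits a word and uses no relation. -/
theorem braidAt_mulRight (a b c : ℕ) (w : (⨂[k]^a V ⊗[k] ⨂[k]^b V) ⊗[k] ⨂[k]^c V) :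
    braidAt σ a (b + c) (mulRight a b c w) =
      mulLeft b c a (braidRight σ b a c (braidLeft σ a b c w)) := by
  refine powTwo_injective _ _ ?_
  simp only [powTwo_braidAt, powTwo_mulRight, powTwo_mulLeft, powThree_braidRight,
    powThree_braidLeft]
  obtain ⟨x, hx⟩ := exists_powThree a b c w
  have h := LinearMap.congr_fun (block_add_right (commute_sigmaAt σ (a + b + c)) 0 a b c) x
  rw [zero_add] at h
  simp only [hx, block_sigmaT_pow]
  exact congrArg _ h

theorem braidAt_mulLeft (a b c : ℕ) (w : (⨂[k]^a V ⊗[k] ⨂[k]^b V) ⊗[k] ⨂[k]^c V) :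
    braidAt σ (a + b) c (mulLeft a b c w) =
      mulRight c a b (braidLeft σ a c b (braidRight σ a b c w)) := by
  refine powTwo_injective _ _ ?_
  simp only [powTwo_braidAt, powTwo_mulRight, powTwo_mulLeft, powThree_braidRight,
    powThree_braidLeft]
  have h := LinearMap.congr_fun (block_add_left (sigmaT σ) 0 a b c) (powThree k V a b c w)
  rw [zero_add] at h
  exact h

/-- The braiding of the tensor algebra. -/
def tensorBraiding : TAlg k V ⊗[k] TAlg k V →ₗ[k] TAlg k V ⊗[k] TAlg k V :=
  sumTensorLift fun m n => TensorProduct.map (pow n) (pow m) ∘ₗ braidAt σ m n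

theorem tensorBraiding_map (m n : ℕ) (w : ⨂[k]^m V ⊗[k] ⨂[k]^n V) :
    tensorBraiding σ (TensorProduct.map (pow m) (pow n) w) =
      TensorProduct.map (pow n) (pow m) (braidAt σ m n w) := by
  induction w using TensorProduct.induction_on with
  | zero => simp
  | add w w' h1 h2 => simp only [map_add, h1, h2]
  | tmul x y =>
    exact sumTensorLift_lof
      (fun m n => TensorProduct.map (pow n) (pow m) ∘ₗ braidAt σ m n) m n x y

variable (k V) in
/-- The inclusion of a tensor product of three tensor powers. -/
def inclThree (a b c : ℕ) : (⨂[k]^a V ⊗[k] ⨂[k]^b V) ⊗[k] ⨂[k]^c V →ₗ[k]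
    (TAlg k V ⊗[k] TAlg k V) ⊗[k] TAlg k V :=
  TensorProduct.map (TensorProduct.map (pow a) (pow b)) (pow c)

theorem inclThree_ext {N : Type*} [AddCommMonoid N] [Module k N]
    {f g : (TAlg k V ⊗[k] TAlg k V) ⊗[k] TAlg k V →ₗ[k] N}
    (h : ∀ a b c w, f (inclThree k V a b c w) = g (inclThree k V a b c w)) : f = g := by
  refine TensorProduct.ext (directSum_tensor_ext fun a b x y =>
    DirectSum.linearMap_ext k fun c => LinearMap.ext fun z => ?_)
  exact h a b c ((x ⊗ₜ y) ⊗ₜ z)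

theorem inclThree_assoc_symm {a b c : ℕ} (x : ⨂[k]^a V) (w : ⨂[k]^b V ⊗[k] ⨂[k]^c V) :
    inclThree k V a b c ((TensorProduct.assoc k _ _ _).symm (x ⊗ₜ w)) =
      (TensorProduct.assoc k (TAlg k V) (TAlg k V) (TAlg k V)).symm
        (pow a x ⊗ₜ TensorProduct.map (pow b) (pow c) w) := by
  induction w using TensorProduct.induction_on with
  | zero => simp
  | add w w' h1 h2 => simp only [TensorProduct.tmul_add, map_add, h1, h2]
  | tmul y z => rfl

theorem sigmaOne_inclThree (a b c : ℕ) (w : (⨂[k]^a V ⊗[k] ⨂[k]^b V) ⊗[k] ⨂[k]^c V) :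
    sigmaOne (tensorBraiding σ) (inclThree k V a b c w) =
      inclThree k V b a c (braidLeft σ a b c w) := by
  induction w using TensorProduct.induction_on with
  | zero => simp
  | add w w' h1 h2 => simp only [map_add, h1, h2]
  | tmul w z =>
    simp only [sigmaOne, inclThree, braidLeft, TensorProduct.map_tmul, LinearMap.rTensor_tmul,
      tensorBraiding_map]

theorem sigmaTwo_inclThree (a b c : ℕ) (w : (⨂[k]^a V ⊗[k] ⨂[k]^b V) ⊗[k] ⨂[k]^c V) :
    sigmaTwo (tensorBraiding σ) (inclThree k V a b c w) =
      inclThree k V a c b (braidRight σ a b c w) := by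
  obtain ⟨w, rfl⟩ := (TensorProduct.assoc k _ _ _).symm.surjective w
  induction w using TensorProduct.induction_on with
  | zero => simp
  | add w w' h1 h2 => simp only [map_add, h1, h2]
  | tmul x w =>
    simp only [sigmaTwo, braidRight, LinearMap.comp_apply, LinearEquiv.coe_coe,
      LinearEquiv.apply_symm_apply, LinearMap.lTensor_tmul, inclThree_assoc_symm,
      tensorBraiding_map]

theorem opTensorId_inclThree (a b c : ℕ) (w : (⨂[k]^a V ⊗[k] ⨂[k]^b V) ⊗[k] ⨂[k]^c V) :
    opTensorId (LinearMap.mul' k (TAlg k V)) (inclThree k V a b c w) =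
      TensorProduct.map (pow (a + b)) (pow c) (mulLeft a b c w) := by
  suffices h : opTensorId (LinearMap.mul' k (TAlg k V)) ∘ₗ inclThree k V a b c =
      TensorProduct.map (pow (a + b)) (pow c) ∘ₗ mulLeft a b c from LinearMap.congr_fun h w
  refine TensorProduct.ext_threefold fun x y z => ?_
  simp only [opTensorId, inclThree, mulLeft, LinearMap.comp_apply, TensorProduct.map_tmul,
    LinearMap.rTensor_tmul, LinearMap.mul'_apply, LinearEquiv.coe_coe, pow_mulEquiv]

theorem idTensorOp_inclThree (a b c : ℕ) (w : (⨂[k]^a V ⊗[k] ⨂[k]^b V) ⊗[k] ⨂[k]^c V) :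
    idTensorOp (LinearMap.mul' k (TAlg k V)) (inclThree k V a b c w) =
      TensorProduct.map (pow a) (pow (b + c)) (mulRight a b c w) := by
  suffices h : idTensorOp (LinearMap.mul' k (TAlg k V)) ∘ₗ inclThree k V a b c =
      TensorProduct.map (pow a) (pow (b + c)) ∘ₗ mulRight a b c from LinearMap.congr_fun h w
  refine TensorProduct.ext_threefold fun x y z => ?_
  simp only [idTensorOp, inclThree, mulRight, LinearMap.comp_apply, TensorProduct.map_tmul,
    LinearMap.lTensor_tmul, LinearMap.mul'_apply, LinearEquiv.coe_coe, pow_mulEquiv,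
    TensorProduct.assoc_tmul]

variable {σ} in
theorem tensorBraiding_isBraiding (hσ : IsBraiding σ) : IsBraiding (tensorBraiding σ) := by
  refine inclThree_ext fun a b c w => ?_
  simp only [LinearMap.comp_apply, sigmaOne_inclThree, sigmaTwo_inclThree,
    braidAt_yangBaxter hσ]

theorem tensorBraiding_isCompatible :
    IsCompatible (LinearMap.mul' k (TAlg k V)) (tensorBraiding σ) where
  id_op := inclThree_ext fun a b c w => by
    simp only [LinearMap.comp_apply, sigmaOne_inclThree, sigmaTwo_inclThree,
      idTensorOp_inclThree, opTensorId_inclThree, tensorBraiding_map, braidAt_mulRight]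
  op_id := inclThree_ext fun a b c w => by
    simp only [LinearMap.comp_apply, sigmaOne_inclThree, sigmaTwo_inclThree,
      idTensorOp_inclThree, opTensorId_inclThree, tensorBraiding_map, braidAt_mulLeft]

/-- The permutation `χ_{1,1}` is a single transposition, and `σ_0` between two empty words is `σ`.
The equivalence `f` is the canonical identification of `V` with its first tensor power. -/
theorem powTwo_one_one (u v : V) :
    ∃ f : V ≃ₗ[k] ⨂[k]^1 V, (∀ v, pow 1 (f v) = gen v) ∧
      braidAt σ 1 1 (f u ⊗ₜ f v) = TensorProduct.map f.toLinearMap f.toLinearMap (σ (u ⊗ₜ v)) := by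
  refine ⟨(PiTensorProduct.subsingletonEquiv (R := k) (s := fun _ => V) (0 : Fin 1)).symm,
    fun v => rfl, powTwo_injective _ _ ?_⟩
  set f := (PiTensorProduct.subsingletonEquiv (R := k) (s := fun _ => V) (0 : Fin 1)).symm
  have h1 : ∀ z : V ⊗[k] V,
      powTwo k V 1 1 (TensorProduct.map f.toLinearMap f.toLinearMap z) = genTwo z := by
    intro z
    induction z using TensorProduct.induction_on with
    | zero => simp
    | add w w' h1 h2 => simp only [map_add, h1, h2]
    | tmul u v => rw [genTwo_tmul, TensorProduct.map_tmul, powTwo_tmul]; rfl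
  have h2 := sigmaT_isolated σ 0 0 (PiTensorProduct.tprod k Fin.elim0) (u ⊗ₜ v)
    (PiTensorProduct.tprod k Fin.elim0)
  rw [pow_zero_tprod, mul_one, mul_one, one_mul, one_mul] at h2
  rw [h1, powTwo_braidAt, block_one, strand_succ, strand_zero, mul_one, ← h2, ← h1]
  rfl

theorem tensorBraiding_gen (u v : V) :
    tensorBraiding σ (gen u ⊗ₜ gen v) = TensorProduct.map gen gen (σ (u ⊗ₜ v)) := by
  obtain ⟨f, hf, h⟩ := powTwo_one_one σ u v
  have h1 := tensorBraiding_map σ 1 1 (f u ⊗ₜ f v)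
  have h2 : pow 1 ∘ₗ f.toLinearMap = (gen : V →ₗ[k] TAlg k V) := LinearMap.ext hf
  rw [h, TensorProduct.map_tmul, hf, hf] at h1
  rw [h1, ← LinearMap.comp_apply, ← TensorProduct.map_comp, h2]

end TensorBraiding

/-! ### Tensor products and subobjects of braided algebras -/

section Abstract

variable {k : Type*} [Field k] {E : Type*} [AddCommGroup E] [Module k E]
  {F : Type*} [AddCommGroup F] [Module k F]

theorem assoc_symm_map (f : E →ₗ[k] F) (x : E) (w : E ⊗[k] E) :
    TensorProduct.map (TensorProduct.map f f) f ((TensorProduct.assoc k E E E).symm (x ⊗ₜ w)) =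
      (TensorProduct.assoc k F F F).symm (f x ⊗ₜ TensorProduct.map f f w) := by
  induction w using TensorProduct.induction_on with
  | zero => simp
  | add w w' h1 h2 => simp only [TensorProduct.tmul_add, map_add, h1, h2]
  | tmul y z => rfl

theorem sigmaTwo_assoc_symm (σ : E ⊗[k] E →ₗ[k] E ⊗[k] E) (x : E) (w : E ⊗[k] E) :
    sigmaTwo σ ((TensorProduct.assoc k E E E).symm (x ⊗ₜ w)) =
      (TensorProduct.assoc k E E E).symm (x ⊗ₜ σ w) := by
  simp only [sigmaTwo, LinearMap.comp_apply, LinearEquiv.coe_coe, LinearEquiv.apply_symm_apply,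
    LinearMap.lTensor_tmul]

/-! ### Transport of braided structures along injective homomorphisms -/

section Hom

variable {σ : E ⊗[k] E →ₗ[k] E ⊗[k] E} {τ : F ⊗[k] F →ₗ[k] F ⊗[k] F} {f : E →ₗ[k] F}

theorem IsBraidedHom.apply (h : IsBraidedHom σ τ f) (w : E ⊗[k] E) :
    TensorProduct.map f f (σ w) = τ (TensorProduct.map f f w) := LinearMap.congr_fun h w

theorem IsBraidedHom.sigmaOne (h : IsBraidedHom σ τ f) (w : (E ⊗[k] E) ⊗[k] E) :
    TensorProduct.map (TensorProduct.map f f) f (sigmaOne σ w) =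
      BraidedDend.sigmaOne τ (TensorProduct.map (TensorProduct.map f f) f w) := by
  induction w using TensorProduct.induction_on with
  | zero => simp
  | add w w' h1 h2 => simp only [map_add, h1, h2]
  | tmul w z =>
    simp only [BraidedDend.sigmaOne, LinearMap.rTensor_tmul, TensorProduct.map_tmul, h.apply]

theorem IsBraidedHom.sigmaTwo (h : IsBraidedHom σ τ f) (w : (E ⊗[k] E) ⊗[k] E) :
    TensorProduct.map (TensorProduct.map f f) f (sigmaTwo σ w) =
      BraidedDend.sigmaTwo τ (TensorProduct.map (TensorProduct.map f f) f w) := by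
  obtain ⟨w, rfl⟩ := (TensorProduct.assoc k E E E).symm.surjective w
  induction w using TensorProduct.induction_on with
  | zero => simp
  | add w w' h1 h2 => simp only [map_add, h1, h2]
  | tmul x w => simp only [sigmaTwo_assoc_symm, assoc_symm_map, h.apply]

variable {p : E ⊗[k] E →ₗ[k] E} {q : F ⊗[k] F →ₗ[k] F}

theorem map_opTensorId (h : f ∘ₗ p = q ∘ₗ TensorProduct.map f f) (w : (E ⊗[k] E) ⊗[k] E) :
    TensorProduct.map f f (opTensorId p w) =
      opTensorId q (TensorProduct.map (TensorProduct.map f f) f w) := by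
  induction w using TensorProduct.induction_on with
  | zero => simp
  | add w w' h1 h2 => simp only [map_add, h1, h2]
  | tmul w z =>
    have h1 : f (p w) = q (TensorProduct.map f f w) := LinearMap.congr_fun h w
    simp only [opTensorId, LinearMap.rTensor_tmul, TensorProduct.map_tmul, h1]

theorem map_idTensorOp (h : f ∘ₗ p = q ∘ₗ TensorProduct.map f f) (w : (E ⊗[k] E) ⊗[k] E) :
    TensorProduct.map f f (idTensorOp p w) =
      idTensorOp q (TensorProduct.map (TensorProduct.map f f) f w) := by
  obtain ⟨w, rfl⟩ := (TensorProduct.assoc k E E E).symm.surjective w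
  induction w using TensorProduct.induction_on with
  | zero => simp
  | add w w' h1 h2 => simp only [map_add, h1, h2]
  | tmul x w =>
    have h1 : f (p w) = q (TensorProduct.map f f w) := LinearMap.congr_fun h w
    simp only [idTensorOp, assoc_symm_map, LinearMap.comp_apply, LinearEquiv.coe_coe,
      LinearEquiv.apply_symm_apply, LinearMap.lTensor_tmul, TensorProduct.map_tmul, h1]

/-- Over a field an injective map has a linear left inverse `g`, and `g ⊗ g` is then a left inverse
of `f ⊗ f`. -/
theorem map_map_injective (hf : Function.Injective f) :
    Function.Injective (TensorProduct.map f f) := by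
  obtain ⟨g, hg⟩ := f.exists_leftInverse_of_injective (LinearMap.ker_eq_bot.2 hf)
  refine Function.LeftInverse.injective (g := TensorProduct.map g g) fun w => ?_
  rw [← LinearMap.comp_apply, ← TensorProduct.map_comp, hg, TensorProduct.map_id,
    LinearMap.id_apply]

theorem map_map_map_injective (hf : Function.Injective f) :
    Function.Injective (TensorProduct.map (TensorProduct.map f f) f) := by
  obtain ⟨g, hg⟩ := f.exists_leftInverse_of_injective (LinearMap.ker_eq_bot.2 hf)
  refine Function.LeftInverse.injective
    (g := TensorProduct.map (TensorProduct.map g g) g) fun w => ?_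
  rw [← LinearMap.comp_apply, ← TensorProduct.map_comp, ← TensorProduct.map_comp, hg,
    TensorProduct.map_id, TensorProduct.map_id, LinearMap.id_apply]

theorem IsBraidedHom.of_comp_injective {V : Type*} [AddCommGroup V] [Module k V]
    {σV : V ⊗[k] V →ₗ[k] V ⊗[k] V} {i : V →ₗ[k] E} (h : IsBraidedHom σ τ f)
    (hf : Function.Injective f) (hi : IsBraidedHom σV τ (f ∘ₗ i)) : IsBraidedHom σV σ i := by
  refine LinearMap.ext fun w => map_map_injective hf ?_
  have h1 := hi.apply w
  rw [TensorProduct.map_comp] at h1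
  rw [LinearMap.comp_apply, LinearMap.comp_apply, h.apply]
  exact h1

theorem IsBraiding.of_injective (hτ : IsBraiding τ) (h : IsBraidedHom σ τ f)
    (hf : Function.Injective f) : IsBraiding σ := by
  refine LinearMap.ext fun w => map_map_map_injective hf ?_
  simp only [LinearMap.comp_apply, h.sigmaOne, h.sigmaTwo]
  exact LinearMap.congr_fun hτ _

theorem IsCompatible.of_injective (hτ : IsCompatible q τ) (h : IsBraidedHom σ τ f)
    (hf : Function.Injective f) (hp : f ∘ₗ p = q ∘ₗ TensorProduct.map f f) :
    IsCompatible p σ where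
  id_op := LinearMap.ext fun w => map_map_injective hf <| by
    simp only [LinearMap.comp_apply, h.apply, map_opTensorId hp, map_idTensorOp hp, h.sigmaOne,
      h.sigmaTwo]
    exact LinearMap.congr_fun hτ.id_op _
  op_id := LinearMap.ext fun w => map_map_injective hf <| by
    simp only [LinearMap.comp_apply, h.apply, map_opTensorId hp, map_idTensorOp hp, h.sigmaOne,
      h.sigmaTwo]
    exact LinearMap.congr_fun hτ.op_id _

end Hom

/-! ### The tensor product of a dendriform algebra and a braided associative algebra -/

section TensorAlgebraProduct

variable {S : Type*} [AddCommGroup S] [Module k S] {T : Type*} [AddCommGroup T] [Module k T]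

/-- The operation `(s ⊗ x, t ⊗ y) ↦ p(s, t) ⊗ m(x, y)` on `S ⊗ T`. -/
def tensorOp (p : S ⊗[k] S →ₗ[k] S) (m : T ⊗[k] T →ₗ[k] T) :
    (S ⊗[k] T) ⊗[k] (S ⊗[k] T) →ₗ[k] S ⊗[k] T :=
  TensorProduct.map p m ∘ₗ (TensorProduct.tensorTensorTensorComm k S T S T).toLinearMap

variable (S) in
/-- The braiding of `S ⊗ T` given by the flip on `S` and the braiding `B` on `T`. -/
def flipBraiding (B : T ⊗[k] T →ₗ[k] T ⊗[k] T) :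
    (S ⊗[k] T) ⊗[k] (S ⊗[k] T) →ₗ[k] (S ⊗[k] T) ⊗[k] (S ⊗[k] T) :=
  (TensorProduct.tensorTensorTensorComm k S S T T).toLinearMap ∘ₗ
    TensorProduct.map (TensorProduct.comm k S S).toLinearMap B ∘ₗ
    (TensorProduct.tensorTensorTensorComm k S T S T).toLinearMap

theorem tensorOp_tmul (p : S ⊗[k] S →ₗ[k] S) (m : T ⊗[k] T →ₗ[k] T) (s t : S) (x y : T) :
    tensorOp p m ((s ⊗ₜ x) ⊗ₜ (t ⊗ₜ y)) = p (s ⊗ₜ t) ⊗ₜ m (x ⊗ₜ y) := rfl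

variable (k T) in
/-- The map `x ⊗ y ↦ (s ⊗ x) ⊗ (t ⊗ y)`. -/
def labelTwo (s t : S) : T ⊗[k] T →ₗ[k] (S ⊗[k] T) ⊗[k] (S ⊗[k] T) :=
  TensorProduct.map (TensorProduct.mk k S T s) (TensorProduct.mk k S T t)

variable (k T) in
/-- The map `x ⊗ y ⊗ z ↦ (s ⊗ x) ⊗ (t ⊗ y) ⊗ (r ⊗ z)`. -/
def labelThree (s t r : S) :
    (T ⊗[k] T) ⊗[k] T →ₗ[k] ((S ⊗[k] T) ⊗[k] (S ⊗[k] T)) ⊗[k] (S ⊗[k] T) :=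
  TensorProduct.map (labelTwo k T s t) (TensorProduct.mk k S T r)

theorem labelThree_assoc_symm (s t r : S) (x : T) (w : T ⊗[k] T) :
    labelThree k T s t r ((TensorProduct.assoc k T T T).symm (x ⊗ₜ w)) =
      (TensorProduct.assoc k (S ⊗[k] T) (S ⊗[k] T) (S ⊗[k] T)).symm
        ((s ⊗ₜ x) ⊗ₜ labelTwo k T t r w) := by
  induction w using TensorProduct.induction_on with
  | zero => simp
  | add w w' h1 h2 => simp only [TensorProduct.tmul_add, map_add, h1, h2]
  | tmul y z => rfl

theorem labelThree_ext {N : Type*} [AddCommMonoid N] [Module k N]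
    {f g : ((S ⊗[k] T) ⊗[k] (S ⊗[k] T)) ⊗[k] (S ⊗[k] T) →ₗ[k] N}
    (h : ∀ s t r w, f (labelThree k T s t r w) = g (labelThree k T s t r w)) : f = g := by
  refine TensorProduct.ext_threefold fun a b c => ?_
  induction a using TensorProduct.induction_on with
  | zero => simp
  | add w w' h1 h2 => simp only [TensorProduct.add_tmul, map_add, h1, h2]
  | tmul s x =>
    induction b using TensorProduct.induction_on with
    | zero => simp
    | add w w' h1 h2 => simp only [TensorProduct.tmul_add, TensorProduct.add_tmul, map_add, h1, h2]
    | tmul t y =>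
      induction c using TensorProduct.induction_on with
      | zero => simp
      | add w w' h1 h2 => simp only [TensorProduct.tmul_add, map_add, h1, h2]
      | tmul r z => exact h s t r ((x ⊗ₜ y) ⊗ₜ z)

variable (B : T ⊗[k] T →ₗ[k] T ⊗[k] T) (p : S ⊗[k] S →ₗ[k] S) (m : T ⊗[k] T →ₗ[k] T)

/-- Elements of `S` serve as labels carried by the strands: the braiding exchanges the labels and
acts by `B` on the rest. With labels fixed, each axiom for `flipBraiding` reduces to the same axiom
for `B`, because both sides permute or multiply the labels alike. -/
theorem flipBraiding_labelTwo (s t : S) (w : T ⊗[k] T) :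
    flipBraiding S B (labelTwo k T s t w) = labelTwo k T t s (B w) := by
  induction w using TensorProduct.induction_on with
  | zero => simp
  | add w w' h1 h2 => simp only [map_add, h1, h2]
  | tmul x y =>
    have h : flipBraiding S B (labelTwo k T s t (x ⊗ₜ y)) =
      TensorProduct.tensorTensorTensorComm k S S T T ((t ⊗ₜ s) ⊗ₜ B (x ⊗ₜ y)) := rfl
    rw [h]
    generalize B (x ⊗ₜ y) = w
    induction w using TensorProduct.induction_on with
    | zero => simp
    | add w w' h1 h2 => simp only [TensorProduct.tmul_add, map_add, h1, h2]
    | tmul x y => rfl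

theorem sigmaOne_labelThree (s t r : S) (w : (T ⊗[k] T) ⊗[k] T) :
    sigmaOne (flipBraiding S B) (labelThree k T s t r w) =
      labelThree k T t s r (sigmaOne B w) := by
  induction w using TensorProduct.induction_on with
  | zero => simp
  | add w w' h1 h2 => simp only [map_add, h1, h2]
  | tmul w z =>
    simp only [sigmaOne, labelThree, TensorProduct.map_tmul, LinearMap.rTensor_tmul,
      flipBraiding_labelTwo]

theorem sigmaTwo_labelThree (s t r : S) (w : (T ⊗[k] T) ⊗[k] T) :
    sigmaTwo (flipBraiding S B) (labelThree k T s t r w) =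
      labelThree k T s r t (sigmaTwo B w) := by
  obtain ⟨w, rfl⟩ := (TensorProduct.assoc k T T T).symm.surjective w
  induction w using TensorProduct.induction_on with
  | zero => simp
  | add w w' h1 h2 => simp only [map_add, h1, h2]
  | tmul x w => simp only [sigmaTwo_assoc_symm, labelThree_assoc_symm, flipBraiding_labelTwo]

theorem opTensorId_labelThree (s t r : S) (w : (T ⊗[k] T) ⊗[k] T) :
    opTensorId (tensorOp p m) (labelThree k T s t r w) =
      labelTwo k T (p (s ⊗ₜ t)) r (opTensorId m w) := by
  suffices h : opTensorId (tensorOp p m) ∘ₗ labelThree k T s t r =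
      labelTwo k T (p (s ⊗ₜ t)) r ∘ₗ opTensorId m from LinearMap.congr_fun h w
  exact TensorProduct.ext_threefold fun x y z => rfl

theorem idTensorOp_labelThree (s t r : S) (w : (T ⊗[k] T) ⊗[k] T) :
    idTensorOp (tensorOp p m) (labelThree k T s t r w) =
      labelTwo k T s (p (t ⊗ₜ r)) (idTensorOp m w) := by
  suffices h : idTensorOp (tensorOp p m) ∘ₗ labelThree k T s t r =
      labelTwo k T s (p (t ⊗ₜ r)) ∘ₗ idTensorOp m from LinearMap.congr_fun h w
  exact TensorProduct.ext_threefold fun x y z => rfl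

variable {B p m}

theorem flipBraiding_isBraiding (hB : IsBraiding B) : IsBraiding (flipBraiding S B) := by
  refine labelThree_ext fun s t r w => ?_
  simp only [LinearMap.comp_apply, sigmaOne_labelThree, sigmaTwo_labelThree]
  exact congrArg _ (LinearMap.congr_fun hB w)

theorem flipBraiding_isCompatible (hB : IsCompatible m B) :
    IsCompatible (tensorOp p m) (flipBraiding S B) where
  id_op := labelThree_ext fun s t r w => by
    simp only [LinearMap.comp_apply, sigmaOne_labelThree, sigmaTwo_labelThree,
      opTensorId_labelThree, idTensorOp_labelThree, flipBraiding_labelTwo]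
    exact congrArg _ (LinearMap.congr_fun hB.id_op w)
  op_id := labelThree_ext fun s t r w => by
    simp only [LinearMap.comp_apply, sigmaOne_labelThree, sigmaTwo_labelThree,
      opTensorId_labelThree, idTensorOp_labelThree, flipBraiding_labelTwo]
    exact congrArg _ (LinearMap.congr_fun hB.op_id w)

theorem tensor_triple_ext {N : Type*} [AddCommMonoid N] [Module k N]
    {f g : ((S ⊗[k] T) ⊗[k] (S ⊗[k] T)) ⊗[k] (S ⊗[k] T) →ₗ[k] N}
    (h : ∀ s t r x y z, f (((s ⊗ₜ x) ⊗ₜ (t ⊗ₜ y)) ⊗ₜ (r ⊗ₜ z)) =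
      g (((s ⊗ₜ x) ⊗ₜ (t ⊗ₜ y)) ⊗ₜ (r ⊗ₜ z))) (a b c : S ⊗[k] T) :
    f ((a ⊗ₜ b) ⊗ₜ c) = g ((a ⊗ₜ b) ⊗ₜ c) := by
  refine LinearMap.congr_fun (f := f) (g := g) (labelThree_ext fun s t r w => ?_) _
  refine LinearMap.congr_fun (f := f ∘ₗ labelThree k T s t r) (g := g ∘ₗ labelThree k T s t r)
    (TensorProduct.ext_threefold fun x y z => ?_) w
  exact h s t r x y z

/-- In each axiom the `T`-components on the two sides differ by a rebracketing, absorbed by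
associativity of `m`; the `S`-components satisfy the axiom itself. -/
theorem tensorOp_isDendriform {q : S ⊗[k] S →ₗ[k] S} (h : IsDendriform p q)
    (hm : ∀ x y z : T, m (m (x ⊗ₜ y) ⊗ₜ z) = m (x ⊗ₜ m (y ⊗ₜ z))) :
    IsDendriform (tensorOp p m) (tensorOp q m) where
  prec_prec := tensor_triple_ext
    (f := tensorOp p m ∘ₗ opTensorId (tensorOp p m))
    (g := tensorOp p m ∘ₗ idTensorOp (tensorOp p m + tensorOp q m)) fun s t r x y z => by
      simp only [LinearMap.comp_apply, opTensorId, idTensorOp, LinearMap.rTensor_tmul,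
        LinearEquiv.coe_coe, TensorProduct.assoc_tmul, LinearMap.lTensor_tmul,
        LinearMap.add_apply, tensorOp_tmul, ← TensorProduct.add_tmul, h.prec_prec, hm]
  succ_prec := tensor_triple_ext
    (f := tensorOp p m ∘ₗ opTensorId (tensorOp q m))
    (g := tensorOp q m ∘ₗ idTensorOp (tensorOp p m)) fun s t r x y z => by
      simp only [LinearMap.comp_apply, opTensorId, idTensorOp, LinearMap.rTensor_tmul,
        LinearEquiv.coe_coe, TensorProduct.assoc_tmul, LinearMap.lTensor_tmul,
        tensorOp_tmul, h.succ_prec, hm]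
  succ_succ := tensor_triple_ext
    (f := tensorOp q m ∘ₗ opTensorId (tensorOp p m + tensorOp q m))
    (g := tensorOp q m ∘ₗ idTensorOp (tensorOp q m)) fun s t r x y z => by
      simp only [LinearMap.comp_apply, opTensorId, idTensorOp, LinearMap.rTensor_tmul,
        LinearEquiv.coe_coe, TensorProduct.assoc_tmul, LinearMap.lTensor_tmul,
        LinearMap.add_apply, tensorOp_tmul, ← TensorProduct.add_tmul, h.succ_succ, hm]

end TensorAlgebraProduct

/-! ### Homomorphisms determined on generators -/

section Generators

variable {V : Type*} [AddCommGroup V] [Module k V]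

/-- `E` is generated by the image of `i` under the operations `p` and `q`. -/
def IsGenerated (i : V →ₗ[k] E) (p q : E ⊗[k] E →ₗ[k] E) : Prop :=
  ∀ P : Submodule k E, (∀ v, i v ∈ P) → (∀ x ∈ P, ∀ y ∈ P, p (x ⊗ₜ y) ∈ P) →
    (∀ x ∈ P, ∀ y ∈ P, q (x ⊗ₜ y) ∈ P) → ∀ x, x ∈ P

variable {i : V →ₗ[k] E} {p q : E ⊗[k] E →ₗ[k] E} {p' q' : F ⊗[k] F →ₗ[k] F}
  {σ : E ⊗[k] E →ₗ[k] E ⊗[k] E} {τ : F ⊗[k] F →ₗ[k] F ⊗[k] F} {f : E →ₗ[k] F}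
  {σV : V ⊗[k] V →ₗ[k] V ⊗[k] V}

theorem apply_tmul (hp : f ∘ₗ p = p' ∘ₗ TensorProduct.map f f) (x y : E) :
    f (p (x ⊗ₜ y)) = p' (f x ⊗ₜ f y) := LinearMap.congr_fun hp (x ⊗ₜ y)

theorem IsGenerated.hom_ext {g : E →ₗ[k] F} (hE : IsGenerated i p q)
    (hfp : f ∘ₗ p = p' ∘ₗ TensorProduct.map f f) (hfq : f ∘ₗ q = q' ∘ₗ TensorProduct.map f f)
    (hgp : g ∘ₗ p = p' ∘ₗ TensorProduct.map g g) (hgq : g ∘ₗ q = q' ∘ₗ TensorProduct.map g g)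
    (h : f ∘ₗ i = g ∘ₗ i) : f = g := by
  refine LinearMap.ext (hE (LinearMap.eqLocus f g) (LinearMap.congr_fun h) ?_ ?_)
  · intro x (hx : f x = g x) y (hy : f y = g y)
    change f _ = g _
    rw [apply_tmul hfp, apply_tmul hgp, hx, hy]
  · intro x (hx : f x = g x) y (hy : f y = g y)
    change f _ = g _
    rw [apply_tmul hfq, apply_tmul hgq, hx, hy]

theorem IsCompatible.apply_op_right (h : IsCompatible p σ) (x y z : E) :
    σ (x ⊗ₜ p (y ⊗ₜ z)) = opTensorId p (sigmaTwo σ (σ (x ⊗ₜ y) ⊗ₜ z)) :=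
  LinearMap.congr_fun h.id_op ((x ⊗ₜ y) ⊗ₜ z)

theorem IsCompatible.apply_op_left (h : IsCompatible p σ) (x y z : E) :
    σ (p (x ⊗ₜ y) ⊗ₜ z) =
      idTensorOp p (sigmaOne σ ((TensorProduct.assoc k E E E).symm (x ⊗ₜ σ (y ⊗ₜ z)))) := by
  rw [← sigmaTwo_assoc_symm]
  exact LinearMap.congr_fun h.op_id ((x ⊗ₜ y) ⊗ₜ z)

theorem opTensorId_sigmaTwo_tmul (x y z : E) :
    opTensorId p (sigmaTwo σ ((x ⊗ₜ y) ⊗ₜ z)) =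
      (p ∘ₗ TensorProduct.mk k E E x).rTensor E (σ (y ⊗ₜ z)) := by
  have h : ((x ⊗ₜ y) ⊗ₜ z : (E ⊗[k] E) ⊗[k] E) =
    (TensorProduct.assoc k E E E).symm (x ⊗ₜ (y ⊗ₜ z)) := rfl
  rw [h, sigmaTwo_assoc_symm]
  generalize σ (y ⊗ₜ z) = w
  induction w using TensorProduct.induction_on with
  | zero => simp
  | add w w' h1 h2 => simp only [TensorProduct.tmul_add, map_add, h1, h2]
  | tmul y z => rfl

theorem map_rTensor_op (hp : f ∘ₗ p = p' ∘ₗ TensorProduct.map f f) (x : E) (w : E ⊗[k] E) :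
    TensorProduct.map f f ((p ∘ₗ TensorProduct.mk k E E x).rTensor E w) =
      (p' ∘ₗ TensorProduct.mk k F F (f x)).rTensor F (TensorProduct.map f f w) := by
  induction w using TensorProduct.induction_on with
  | zero => simp
  | add w w' h1 h2 => simp only [map_add, h1, h2]
  | tmul y z =>
    simp only [LinearMap.rTensor_tmul, TensorProduct.map_tmul, LinearMap.comp_apply,
      TensorProduct.mk_apply, apply_tmul hp]

/-- The braidings of `E` and `F` agree on `i(V) ⊗ y`, and that of `E` maps it to `E ⊗ i(V)`. -/
def BraidsGenerators (i : V →ₗ[k] E) (σ : E ⊗[k] E →ₗ[k] E ⊗[k] E)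
    (τ : F ⊗[k] F →ₗ[k] F ⊗[k] F) (f : E →ₗ[k] F) : Submodule k E where
  carrier := {y | ∀ v, (∃ w : E ⊗[k] V, σ (i v ⊗ₜ y) = i.lTensor E w) ∧
    TensorProduct.map f f (σ (i v ⊗ₜ y)) = τ (f (i v) ⊗ₜ f y)}
  zero_mem' v := ⟨⟨0, by simp⟩, by simp⟩
  add_mem' {y z} hy hz v := by
    obtain ⟨⟨w, hw⟩, h1⟩ := hy v
    obtain ⟨⟨w', hw'⟩, h2⟩ := hz v
    refine ⟨⟨w + w', by rw [TensorProduct.tmul_add, map_add, map_add, hw, hw']⟩, ?_⟩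
    simp only [TensorProduct.tmul_add, map_add, h1, h2]
  smul_mem' c y hy v := by
    obtain ⟨⟨w, hw⟩, h1⟩ := hy v
    refine ⟨⟨c • w, by rw [TensorProduct.tmul_smul, map_smul, map_smul, hw]⟩, ?_⟩
    simp only [TensorProduct.tmul_smul, map_smul, h1]

/-- A generator braided with `p(y, z)` first crosses `y`, then `z`. After the first crossing it must
still be a generator for the hypothesis on `z` to apply; this is why membership also requires the
image to lie in `E ⊗ i(V)`. -/
theorem BraidsGenerators.op_mem (hσ : IsCompatible p σ) (hτ : IsCompatible p' τ)
    (hp : f ∘ₗ p = p' ∘ₗ TensorProduct.map f f) {y z : E} (hy : y ∈ BraidsGenerators i σ τ f)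
    (hz : z ∈ BraidsGenerators i σ τ f) : p (y ⊗ₜ z) ∈ BraidsGenerators i σ τ f := by
  have key : ∀ w : E ⊗[k] V,
      (∃ w', opTensorId p (sigmaTwo σ (i.lTensor E w ⊗ₜ z)) = i.lTensor E w') ∧
      TensorProduct.map f f (opTensorId p (sigmaTwo σ (i.lTensor E w ⊗ₜ z))) =
        opTensorId p' (sigmaTwo τ (TensorProduct.map f f (i.lTensor E w) ⊗ₜ f z)) := by
    intro w
    induction w using TensorProduct.induction_on with
    | zero => exact ⟨⟨0, by simp⟩, by simp⟩
    | add w w' h1 h2 =>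
      obtain ⟨⟨a, ha⟩, h1⟩ := h1
      obtain ⟨⟨b, hb⟩, h2⟩ := h2
      refine ⟨⟨a + b, ?_⟩, ?_⟩
      · simp only [map_add, TensorProduct.add_tmul, ha, hb]
      · simp only [map_add, TensorProduct.add_tmul, h1, h2]
    | tmul e v =>
      obtain ⟨⟨a, ha⟩, h1⟩ := hz v
      simp only [LinearMap.lTensor_tmul, TensorProduct.map_tmul, opTensorId_sigmaTwo_tmul]
      refine ⟨⟨(p ∘ₗ TensorProduct.mk k E E e).rTensor V a, ?_⟩, ?_⟩
      · rw [ha, ← LinearMap.comp_apply, ← LinearMap.comp_apply, LinearMap.rTensor_comp_lTensor,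
          LinearMap.lTensor_comp_rTensor]
      · rw [map_rTensor_op hp, h1]
  intro v
  obtain ⟨⟨a, ha⟩, h1⟩ := hy v
  rw [hσ.apply_op_right, apply_tmul hp, hτ.apply_op_right, ← h1, ha]
  exact key a

/-- A homomorphism of algebras with two operations compatible with braidings is braided if it is
braided on generators. -/
theorem IsGenerated.isBraidedHom (hE : IsGenerated i p q)
    (hi : IsBraidedHom σV σ i) (hfi : IsBraidedHom σV τ (f ∘ₗ i))
    (hσp : IsCompatible p σ) (hσq : IsCompatible q σ)
    (hτp : IsCompatible p' τ) (hτq : IsCompatible q' τ)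
    (hfp : f ∘ₗ p = p' ∘ₗ TensorProduct.map f f) (hfq : f ∘ₗ q = q' ∘ₗ TensorProduct.map f f) :
    IsBraidedHom σ τ f := by
  -- The left argument is a generator and the right one is arbitrary. For two generators, `σ (i v ⊗
  -- i u) = (i ⊗ i) (σV (v ⊗ u))`, which lies in `E ⊗ i(V)`.
  have h1 : ∀ y, y ∈ BraidsGenerators i σ τ f := by
    refine hE _ (fun u v => ?_) (fun _ hx _ hy => BraidsGenerators.op_mem hσp hτp hfp hx hy)
      (fun _ hx _ hy => BraidsGenerators.op_mem hσq hτq hfq hx hy)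
    have h1 := (hi.apply (v ⊗ₜ u)).symm
    have h2 := hfi.apply (v ⊗ₜ u)
    rw [TensorProduct.map_tmul] at h1 h2
    refine ⟨⟨i.rTensor V (σV (v ⊗ₜ u)), ?_⟩, ?_⟩
    · rw [h1, ← LinearMap.lTensor_comp_rTensor]
      rfl
    · rw [h1, ← LinearMap.comp_apply, ← TensorProduct.map_comp, h2]
      rfl
  -- Now the left argument is built up by products. The element `z` first crosses `y`, and what
  -- crosses `x` afterwards is an uncontrolled element of `E`; hence the property of `x` must hold
  -- against every right argument.
  have key : ∀ {r : E ⊗[k] E →ₗ[k] E} {r' : F ⊗[k] F →ₗ[k] F}, IsCompatible r σ →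
      IsCompatible r' τ → f ∘ₗ r = r' ∘ₗ TensorProduct.map f f → ∀ {x y : E},
      (∀ z, TensorProduct.map f f (σ (x ⊗ₜ z)) = τ (f x ⊗ₜ f z)) →
      (∀ z, TensorProduct.map f f (σ (y ⊗ₜ z)) = τ (f y ⊗ₜ f z)) →
      ∀ z, TensorProduct.map f f (σ (r (x ⊗ₜ y) ⊗ₜ z)) = τ (f (r (x ⊗ₜ y)) ⊗ₜ f z) := by
    intro r r' hr hr' hf x y hx hy z
    rw [hr.apply_op_left, map_idTensorOp hf, apply_tmul hf, hr'.apply_op_left, ← hy z]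
    congr 1
    generalize σ (y ⊗ₜ z) = w
    induction w using TensorProduct.induction_on with
    | zero => simp
    | add w w' h1 h2 => simp only [map_add, TensorProduct.tmul_add, h1, h2]
    | tmul a b =>
      simp only [TensorProduct.assoc_symm_tmul, TensorProduct.map_tmul, sigmaOne,
        LinearMap.rTensor_tmul, hx]
  have h2 := hE
    { carrier := {x | ∀ z, TensorProduct.map f f (σ (x ⊗ₜ z)) = τ (f x ⊗ₜ f z)}
      zero_mem' := fun z => by simp
      add_mem' := fun {x y} hx hy z => by
        simp only [TensorProduct.add_tmul, map_add, hx z, hy z]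
      smul_mem' := fun c x hx z => by
        simp only [← TensorProduct.smul_tmul', map_smul, hx z] }
    (fun v z => (h1 z v).2) (fun _ hx _ hy => key hσp hτp hfp hx hy)
    (fun _ hx _ hy => key hσq hτq hfq hx hy)
  exact TensorProduct.ext' fun x y => h2 x y

end Generators

end Abstract

/-! ### The dendriform algebra of decorated trees -/

section TreeAlgebra

variable {k : Type*} [Field k] {V : Type*} [AddCommGroup V] [Module k V]

theorem graft_deco (l r : Shape) (a : ⨂[k]^l.numNodes V) (v : V) (b : ⨂[k]^r.numNodes V) :
    graft (deco l a ⊗ₜ (v ⊗ₜ deco r b)) = deco' (join l r) (nodeEquiv l r (a ⊗ₜ (v ⊗ₜ b))) := by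
  have h : sumTensorLift (fun l r : Shape => TensorProduct.curry (graftAt (V := V) l r))
      (deco l a ⊗ₜ[k] deco r b) = TensorProduct.curry (graftAt l r) (a ⊗ₜ b) :=
    sumTensorLift_lof (fun l r : Shape => TensorProduct.curry (graftAt (V := V) l r)) l r a b
  simp only [graft, LinearMap.comp_apply, LinearMap.lTensor_tmul, LinearEquiv.coe_coe,
    TensorProduct.comm_tmul, TensorProduct.assoc_symm_tmul, TensorProduct.lift.tmul, h]
  rfl

theorem incl_deco' (t : Shape') (a : ⨂[k]^t.1.numNodes V) : incl (deco' t a) = deco t.1 a := by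
  simp only [incl, deco', DirectSum.toModule_lof]

theorem deco_nil (a : ⨂[k]^0 V) :
    deco BinaryTree.nil a = PiTensorProduct.isEmptyEquiv (Fin 0) a • (leaf : TreeMod k V) := by
  obtain ⟨c, rfl⟩ := (PiTensorProduct.isEmptyEquiv (R := k) (s := fun _ => V)
    (Fin 0)).symm.surjective a
  rw [LinearEquiv.apply_symm_apply, leaf, ← map_smul]
  congr 1

theorem exists_deco_nil (a : ⨂[k]^0 V) :
    ∃ c : k, deco BinaryTree.nil a = c • (leaf : TreeMod k V) := ⟨_, deco_nil a⟩

/-- In `𝒴(V)` a branch is either a multiple of the unit or of positive degree. This is the case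
distinction in every argument about branches below. -/
theorem deco_cases (t : Shape) (a : ⨂[k]^t.numNodes V) :
    (∃ c : k, deco t a = c • (leaf : TreeMod k V)) ∨
      ∃ h : t ≠ .nil, deco t a = incl (deco' ⟨t, h⟩ a) := by
  match t, a with
  | .nil, a => exact Or.inl (exists_deco_nil a)
  | .node () l r, a => exact Or.inr ⟨by simp, (incl_deco' (join l r) a).symm⟩

theorem deco'_join_induction {l r : Shape} {P : TreeMod' k V → Prop} (h0 : P 0)
    (hadd : ∀ x y, P x → P y → P (x + y))
    (h : ∀ a v b, P (graft (deco l a ⊗ₜ (v ⊗ₜ deco r b)))) (a : ⨂[k]^(join l r).1.numNodes V) :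
    P (deco' (join l r) a) := by
  obtain ⟨w, rfl⟩ := (nodeEquiv l r).surjective a
  induction w using TensorProduct.induction_on with
  | zero => rw [map_zero, map_zero]; exact h0
  | add w w' h1 h2 => rw [map_add, map_add]; exact hadd _ _ h1 h2
  | tmul a w =>
    induction w using TensorProduct.induction_on with
    | zero => rw [TensorProduct.tmul_zero, map_zero, map_zero]; exact h0
    | add w w' h1 h2 => rw [TensorProduct.tmul_add, map_add, map_add]; exact hadd _ _ h1 h2
    | tmul v b => rw [← graft_deco]; exact h a v b

theorem treeMod'_induction {P : TreeMod' k V → Prop} (h0 : P 0)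
    (hadd : ∀ x y, P x → P y → P (x + y)) (h : ∀ x v y, P (graft (x ⊗ₜ (v ⊗ₜ y))))
    (x : TreeMod' k V) : P x := by
  induction x using DirectSum.induction_on with
  | zero => exact h0
  | add x y hx hy => exact hadd _ _ hx hy
  | of t a =>
    obtain ⟨t, ht⟩ := t
    match t, ht, a with
    | .nil, ht, _ => exact absurd rfl ht
    | .node () l r, _, a =>
      exact deco'_join_induction (l := l) (r := r) h0 hadd (fun a v b => h _ _ _) a

theorem treeMod_induction {P : TreeMod k V → Prop} (hadd : ∀ x y, P x → P y → P (x + y))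
    (h : ∀ t a, P (deco t a)) (x : TreeMod k V) : P x := by
  induction x using DirectSum.induction_on with
  | zero => rw [← map_zero (deco .nil)]; exact h .nil 0
  | add x y hx hy => exact hadd _ _ hx hy
  | of t a => exact h t a

theorem treeMod'_deco_induction {P : TreeMod' k V → Prop} (h0 : P 0)
    (hadd : ∀ x y, P x → P y → P (x + y)) (h : ∀ t a, P (deco' t a)) (x : TreeMod' k V) :
    P x := by
  induction x using DirectSum.induction_on with
  | zero => exact h0
  | add x y hx hy => exact hadd _ _ hx hy
  | of t a => exact h t a

variable (k V) in
/-- The product `*` on `𝒴(V)`. -/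
def treeStar : TreeMod k V ⊗[k] TreeMod k V →ₗ[k] TreeMod k V := sumTensorLift starAt

theorem treeStar_deco (s t : Shape) (a : ⨂[k]^s.numNodes V) (b : ⨂[k]^t.numNodes V) :
    treeStar k V (deco s a ⊗ₜ deco t b) = starAt s t (a ⊗ₜ b) := sumTensorLift_lof starAt s t a b

theorem treePrec_deco' (s t : Shape') (a : ⨂[k]^s.1.numNodes V) (b : ⨂[k]^t.1.numNodes V) :
    treePrec k V (deco' s a ⊗ₜ deco' t b) = precAt s t (a ⊗ₜ b) := sumTensorLift_lof precAt s t a b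

theorem treeSucc_deco' (s t : Shape') (a : ⨂[k]^s.1.numNodes V) (b : ⨂[k]^t.1.numNodes V) :
    treeSucc k V (deco' s a ⊗ₜ deco' t b) = succAt s t (a ⊗ₜ b) := sumTensorLift_lof succAt s t a b

theorem starLeft_tmul (t : Shape) (x : ⨂[k]^0 V) (a : ⨂[k]^t.numNodes V) :
    starLeft t (x ⊗ₜ a) = PiTensorProduct.isEmptyEquiv (Fin 0) x • deco t a := by
  simp only [starLeft, LinearMap.comp_apply, LinearMap.rTensor_tmul, LinearEquiv.coe_coe,
    TensorProduct.lid_tmul, map_smul]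

theorem starRight_tmul (t : Shape) (a : ⨂[k]^t.numNodes V) (x : ⨂[k]^0 V) :
    starRight t (a ⊗ₜ x) = PiTensorProduct.isEmptyEquiv (Fin 0) x • deco t a := by
  simp only [starRight, LinearMap.comp_apply, LinearMap.lTensor_tmul, LinearEquiv.coe_coe,
    TensorProduct.rid_tmul, map_smul]

theorem precStep_tmul (l r t : Shape)
    (S : ⨂[k]^r.numNodes V ⊗[k] ⨂[k]^t.numNodes V →ₗ[k] TreeMod k V)
    (a : ⨂[k]^l.numNodes V) (v : V) (b : ⨂[k]^r.numNodes V) (c : ⨂[k]^t.numNodes V) :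
    precStep l r t S (nodeEquiv l r (a ⊗ₜ (v ⊗ₜ b)) ⊗ₜ c) =
      graft (deco l a ⊗ₜ (v ⊗ₜ S (b ⊗ₜ c))) := by
  simp only [precStep, LinearMap.comp_apply, LinearMap.rTensor_tmul, LinearEquiv.coe_coe,
    LinearEquiv.symm_apply_apply, TensorProduct.assoc_tmul, LinearMap.lTensor_tmul,
    TensorProduct.map_tmul]

theorem succStep_tmul (s l r : Shape)
    (S : ⨂[k]^s.numNodes V ⊗[k] ⨂[k]^l.numNodes V →ₗ[k] TreeMod k V)
    (c : ⨂[k]^s.numNodes V) (a : ⨂[k]^l.numNodes V) (v : V) (b : ⨂[k]^r.numNodes V) :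
    succStep s l r S (c ⊗ₜ nodeEquiv l r (a ⊗ₜ (v ⊗ₜ b))) =
      graft (S (c ⊗ₜ a) ⊗ₜ (v ⊗ₜ deco r b)) := by
  simp only [succStep, LinearMap.comp_apply, LinearMap.lTensor_tmul, LinearEquiv.coe_coe,
    LinearEquiv.symm_apply_apply, TensorProduct.assoc_symm_tmul, TensorProduct.map_tmul]

theorem leaf_star (y : TreeMod k V) : treeStar k V (leaf ⊗ₜ y) = y := by
  induction y using treeMod_induction with
  | hadd x y hx hy => rw [TensorProduct.tmul_add, map_add, hx, hy]
  | h t a =>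
    refine (treeStar_deco .nil t _ a).trans ?_
    rw [starAt]
    refine (starLeft_tmul t _ a).trans ?_
    exact (congrArg (· • deco t a) (PiTensorProduct.isEmptyEquiv_apply_tprod (Fin 0) _)).trans
      (one_smul k _)

theorem star_leaf (x : TreeMod k V) : treeStar k V (x ⊗ₜ leaf) = x := by
  induction x using treeMod_induction with
  | hadd x y hx hy => rw [TensorProduct.add_tmul, map_add, hx, hy]
  | h t a =>
    -- The recursion for `*` tests its left argument first, so `| * |` is computed by the left unit
    -- rule.
    match t, a with
    | .nil, a =>
      obtain ⟨c, hc⟩ := exists_deco_nil a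
      rw [hc, ← TensorProduct.smul_tmul', map_smul, leaf_star]
    | .node () l r, a =>
      refine (treeStar_deco (.node () l r) .nil a _).trans ?_
      rw [starAt]
      refine (starRight_tmul _ a _).trans ?_
      exact (congrArg (· • deco _ a) (PiTensorProduct.isEmptyEquiv_apply_tprod (Fin 0) _)).trans
        (one_smul k _)

theorem prec_graft (x : TreeMod k V) (v : V) (y : TreeMod k V) (z : TreeMod' k V) :
    treePrec k V (graft (x ⊗ₜ (v ⊗ₜ y)) ⊗ₜ z) =
      graft (x ⊗ₜ (v ⊗ₜ treeStar k V (y ⊗ₜ incl z))) := by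
  induction x using treeMod_induction with
  | hadd x x' hx hx' => simp only [TensorProduct.add_tmul, map_add, hx, hx']
  | h l a =>
    induction y using treeMod_induction with
    | hadd x x' hx hx' =>
      simp only [TensorProduct.add_tmul, TensorProduct.tmul_add, map_add, hx, hx']
    | h r b =>
      induction z using treeMod'_deco_induction with
      | h0 => simp
      | hadd x x' hx hx' => simp only [TensorProduct.tmul_add, map_add, hx, hx']
      | h t c =>
        rw [graft_deco, treePrec_deco', incl_deco', treeStar_deco, precAt]
        exact precStep_tmul l r t.1 _ a v b c

theorem succ_graft (z : TreeMod' k V) (x : TreeMod k V) (v : V) (y : TreeMod k V) :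
    treeSucc k V (z ⊗ₜ graft (x ⊗ₜ (v ⊗ₜ y))) =
      graft (treeStar k V (incl z ⊗ₜ x) ⊗ₜ (v ⊗ₜ y)) := by
  induction x using treeMod_induction with
  | hadd x x' hx hx' =>
    simp only [TensorProduct.add_tmul, TensorProduct.tmul_add, map_add, hx, hx']
  | h l a =>
    induction y using treeMod_induction with
    | hadd x x' hx hx' => simp only [TensorProduct.tmul_add, map_add, hx, hx']
    | h r b =>
      induction z using treeMod'_deco_induction with
      | h0 => simp
      | hadd x x' hx hx' => simp only [TensorProduct.add_tmul, map_add, hx, hx']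
      | h t c =>
        rw [graft_deco, treeSucc_deco', incl_deco', treeStar_deco, succAt]
        exact succStep_tmul t.1 l r _ c a v b

theorem star_incl (x y : TreeMod' k V) :
    treeStar k V (incl x ⊗ₜ incl y) = incl (treePrec k V (x ⊗ₜ y) + treeSucc k V (x ⊗ₜ y)) := by
  induction x using treeMod'_deco_induction with
  | h0 => simp
  | hadd x x' hx hx' =>
    simp only [TensorProduct.add_tmul, map_add] at hx hx' ⊢
    rw [hx, hx']
    abel
  | h s a =>
    induction y using treeMod'_deco_induction with
    | h0 => simp
    | hadd x x' hx hx' =>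
      simp only [TensorProduct.tmul_add, map_add] at hx hx' ⊢
      rw [hx, hx']
      abel
    | h t b =>
      rw [treePrec_deco', treeSucc_deco', incl_deco', incl_deco', treeStar_deco]
      obtain ⟨s, hs⟩ := s
      obtain ⟨t, ht⟩ := t
      match s, hs, t, ht, a, b with
      | .nil, hs, _, _, _, _ => exact absurd rfl hs
      | _, _, .nil, ht, _, _ => exact absurd rfl ht
      | .node () l r, _, .node () l' r', _, a, b =>
        rw [starAt, precAt, succAt]
        rfl

/-- Both sides only change the right branch `y` of the first factor, multiplying it by `Y` and `Z`.
The axiom is thus associativity of `*` with the smaller tree `y` in first place. In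
`succ_succ_of_assoc` the left branch of the third factor plays this part. -/
theorem prec_prec_of_assoc (x : TreeMod k V) (v : V) (y : TreeMod k V) (Y Z : TreeMod' k V)
    (h : treeStar k V (treeStar k V (y ⊗ₜ incl Y) ⊗ₜ incl Z) =
      treeStar k V (y ⊗ₜ treeStar k V (incl Y ⊗ₜ incl Z))) :
    treePrec k V (treePrec k V (graft (x ⊗ₜ (v ⊗ₜ y)) ⊗ₜ Y) ⊗ₜ Z) =
      treePrec k V (graft (x ⊗ₜ (v ⊗ₜ y)) ⊗ₜ
        (treePrec k V (Y ⊗ₜ Z) + treeSucc k V (Y ⊗ₜ Z))) := by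
  rw [prec_graft, prec_graft, prec_graft, h, star_incl Y Z]

theorem succ_succ_of_assoc (x : TreeMod k V) (v : V) (y : TreeMod k V) (X Y : TreeMod' k V)
    (h : treeStar k V (treeStar k V (incl X ⊗ₜ incl Y) ⊗ₜ x) =
      treeStar k V (incl X ⊗ₜ treeStar k V (incl Y ⊗ₜ x))) :
    treeSucc k V ((treePrec k V (X ⊗ₜ Y) + treeSucc k V (X ⊗ₜ Y)) ⊗ₜ graft (x ⊗ₜ (v ⊗ₜ y))) =
      treeSucc k V (X ⊗ₜ treeSucc k V (Y ⊗ₜ graft (x ⊗ₜ (v ⊗ₜ y)))) := by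
  rw [succ_graft, succ_graft, succ_graft, ← h, star_incl X Y]

/-- The product with `X` alters only the left branch of `Y` and the product with `Z` only the right
branch, so the two are independent and no associativity is involved. -/
theorem tree_succ_prec (X Y Z : TreeMod' k V) :
    treePrec k V (treeSucc k V (X ⊗ₜ Y) ⊗ₜ Z) = treeSucc k V (X ⊗ₜ treePrec k V (Y ⊗ₜ Z)) := by
  induction Y using treeMod'_induction with
  | h0 => simp
  | hadd x x' hx hx' => simp only [TensorProduct.tmul_add, TensorProduct.add_tmul, map_add, hx, hx']
  | h x v y => rw [succ_graft, prec_graft, prec_graft, succ_graft]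

/-- Associativity of `*` is the sum of the three dendriform axioms, the middle one being already
available. -/
theorem star_assoc_of (X Y Z : TreeMod' k V)
    (h1 : treePrec k V (treePrec k V (X ⊗ₜ Y) ⊗ₜ Z) =
      treePrec k V (X ⊗ₜ (treePrec k V (Y ⊗ₜ Z) + treeSucc k V (Y ⊗ₜ Z))))
    (h2 : treeSucc k V ((treePrec k V (X ⊗ₜ Y) + treeSucc k V (X ⊗ₜ Y)) ⊗ₜ Z) =
      treeSucc k V (X ⊗ₜ treeSucc k V (Y ⊗ₜ Z))) :
    treeStar k V (treeStar k V (incl X ⊗ₜ incl Y) ⊗ₜ incl Z) =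
      treeStar k V (incl X ⊗ₜ treeStar k V (incl Y ⊗ₜ incl Z)) := by
  rw [star_incl, star_incl, star_incl, star_incl, h2, ← h1]
  simp only [TensorProduct.add_tmul, TensorProduct.tmul_add, map_add, tree_succ_prec]
  abel

/-- Axioms and associativity are proved together by induction on the total number of vertices: the
outer axioms require associativity only for a triple in which one tree is replaced by a proper
branch. -/
theorem star_assoc_deco (n : ℕ) (s t u : Shape) (hn : s.numNodes + t.numNodes + u.numNodes ≤ n)
    (a : ⨂[k]^s.numNodes V) (b : ⨂[k]^t.numNodes V) (c : ⨂[k]^u.numNodes V) :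
    treeStar k V (treeStar k V (deco s a ⊗ₜ deco t b) ⊗ₜ deco u c) =
      treeStar k V (deco s a ⊗ₜ treeStar k V (deco t b ⊗ₜ deco u c)) := by
  induction n generalizing s t u with
  | zero =>
    match s, a with
    | .nil, a =>
      obtain ⟨e, he⟩ := exists_deco_nil a
      simp only [he, ← TensorProduct.smul_tmul', map_smul, leaf_star]
    | .node () l r, a => exact absurd hn (by simp [BinaryTree.numNodes])
  | succ n ih =>
    match s, t, u, hn, a, b, c with
    | .nil, _, _, _, a, _, _ =>
      obtain ⟨e, he⟩ := exists_deco_nil a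
      simp only [he, ← TensorProduct.smul_tmul', map_smul, leaf_star]
    | _, .nil, _, _, _, b, _ =>
      obtain ⟨e, he⟩ := exists_deco_nil b
      simp only [he, ← TensorProduct.smul_tmul', TensorProduct.tmul_smul, map_smul, leaf_star,
        star_leaf]
    | _, _, .nil, _, _, _, c =>
      obtain ⟨e, he⟩ := exists_deco_nil c
      simp only [he, TensorProduct.tmul_smul, map_smul, star_leaf]
    | .node () l r, .node () l' r', .node () l'' r'', hn, a, b, c =>
      simp only [BinaryTree.numNodes] at hn
      rw [← incl_deco' (join l r) a, ← incl_deco' (join l' r') b, ← incl_deco' (join l'' r'') c]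
      refine star_assoc_of _ _ _ ?_ ?_
      · refine deco'_join_induction (P := fun X => treePrec k V (treePrec k V (X ⊗ₜ _) ⊗ₜ _) =
          treePrec k V (X ⊗ₜ _)) (by simp) (fun x x' hx hx' => ?_) (fun a v d => ?_) a
        · simp only [TensorProduct.add_tmul, map_add, hx, hx']
        · refine prec_prec_of_assoc _ _ _ _ _ ?_
          rw [incl_deco', incl_deco']
          exact ih _ _ _ (by simp only [BinaryTree.numNodes]; omega) _ _ _
      · refine deco'_join_induction (P := fun Z => treeSucc k V (_ ⊗ₜ Z) =
          treeSucc k V (_ ⊗ₜ treeSucc k V (_ ⊗ₜ Z))) (by simp) (fun x x' hx hx' => ?_)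
          (fun a v d => ?_) c
        · simp only [TensorProduct.tmul_add, map_add, hx, hx']
        · refine succ_succ_of_assoc _ _ _ _ _ ?_
          rw [incl_deco', incl_deco']
          exact ih _ _ _ (by simp only [BinaryTree.numNodes]; omega) _ _ _

theorem star_assoc (x y z : TreeMod k V) :
    treeStar k V (treeStar k V (x ⊗ₜ y) ⊗ₜ z) = treeStar k V (x ⊗ₜ treeStar k V (y ⊗ₜ z)) := by
  induction x using treeMod_induction with
  | hadd x x' hx hx' => simp only [TensorProduct.add_tmul, map_add, hx, hx']
  | h l a =>
    induction y using treeMod_induction with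
    | hadd x x' hx hx' =>
      simp only [TensorProduct.add_tmul, TensorProduct.tmul_add, map_add, hx, hx']
    | h r b =>
      induction z using treeMod_induction with
      | hadd x x' hx hx' => simp only [TensorProduct.tmul_add, map_add, hx, hx']
      | h t c => exact star_assoc_deco _ _ _ _ le_rfl _ _ _

variable (k V) in
theorem tree_isDendriform : IsDendriform (treePrec k V) (treeSucc k V) where
  prec_prec X Y Z := by
    induction X using treeMod'_induction with
    | h0 => simp
    | hadd x x' hx hx' => simp only [TensorProduct.add_tmul, map_add, hx, hx']
    | h x v y => exact prec_prec_of_assoc _ _ _ _ _ (star_assoc _ _ _)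
  succ_prec := tree_succ_prec
  succ_succ X Y Z := by
    induction Z using treeMod'_induction with
    | h0 => simp
    | hadd x x' hx hx' => simp only [TensorProduct.tmul_add, map_add] at hx hx' ⊢; rw [hx, hx']
    | h x v y => exact succ_succ_of_assoc _ _ _ _ _ (star_assoc _ _ _)

theorem treeOne_apply (v : V) : treeOne k V v = graft (leaf ⊗ₜ (v ⊗ₜ leaf)) := rfl

theorem succ_graft_leaf (X : TreeMod' k V) (v : V) (y : TreeMod k V) :
    treeSucc k V (X ⊗ₜ graft (leaf ⊗ₜ (v ⊗ₜ y))) = graft (incl X ⊗ₜ (v ⊗ₜ y)) := by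
  rw [succ_graft, star_leaf]

theorem prec_graft_leaf (x : TreeMod k V) (v : V) (Y : TreeMod' k V) :
    treePrec k V (graft (x ⊗ₜ (v ⊗ₜ leaf)) ⊗ₜ Y) = graft (x ⊗ₜ (v ⊗ₜ incl Y)) := by
  rw [prec_graft, leaf_star]

-- A tree `X ∨_v Z` is `(X ≻ Y[v]) ≺ Z`, and the branches are generated by induction. A branch equal
-- to `|` contributes only a scalar.
variable (k V) in
theorem tree_isGenerated : IsGenerated (treeOne k V) (treePrec k V) (treeSucc k V) := by
  intro P h1 hp hs
  have key : ∀ (t : Shape) (ht : t ≠ .nil) (a : ⨂[k]^t.numNodes V), deco' ⟨t, ht⟩ a ∈ P := by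
    intro t
    induction t with
    | nil => exact fun h => absurd rfl h
    | node u l r ihl ihr =>
      intro _ a
      refine deco'_join_induction (l := l) (r := r) (P := fun X => X ∈ P) P.zero_mem
        (fun _ _ => P.add_mem) (fun c v b => ?_) a
      -- The intermediate tree `X ∨_v |`, that is `X ≻ Y[v]`, before the right branch is attached.
      have hl : graft (deco l c ⊗ₜ (v ⊗ₜ leaf)) ∈ P := by
        obtain ⟨e, he⟩ | ⟨h, he⟩ := deco_cases l c
        · rw [he, ← TensorProduct.smul_tmul', map_smul]
          exact P.smul_mem _ (h1 v)
        · rw [he, ← succ_graft_leaf]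
          exact hs _ (ihl h c) _ (h1 v)
      obtain ⟨e, he⟩ | ⟨h, he⟩ := deco_cases r b
      · rw [he, TensorProduct.tmul_smul, TensorProduct.tmul_smul, map_smul]
        exact P.smul_mem _ hl
      · rw [he, ← prec_graft_leaf]
        exact hp _ hl _ (ihr h b)
  exact treeMod'_deco_induction P.zero_mem (fun _ _ => P.add_mem) fun t a => key t.1 t.2 a

end TreeAlgebra

/-! ### The universal property among dendriform algebras -/

section Fold

variable {k : Type*} [Field k] {V : Type*} [AddCommGroup V] [Module k V]
  {D : Type*} [AddCommGroup D] [Module k D] (prec succ : D ⊗[k] D →ₗ[k] D) (φ : V →ₗ[k] D)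

/-- The operation `≻` with a unit adjoined to the left factor. -/
def unitalSucc : k × D →ₗ[k] D →ₗ[k] D :=
  LinearMap.lsmul k D ∘ₗ LinearMap.fst k k D + TensorProduct.curry succ ∘ₗ LinearMap.snd k k D

/-- The operation `≺` with a unit adjoined to the right factor, as a map on the right factor. -/
def unitalPrec : k × D →ₗ[k] D →ₗ[k] D :=
  LinearMap.lsmul k D ∘ₗ LinearMap.fst k k D +
    (TensorProduct.curry prec).flip ∘ₗ LinearMap.snd k k D

theorem unitalSucc_apply (x : k × D) (d : D) :
    unitalSucc succ x d = x.1 • d + succ (x.2 ⊗ₜ d) := rfl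

theorem unitalPrec_apply (x : k × D) (d : D) :
    unitalPrec prec x d = x.1 • d + prec (d ⊗ₜ x.2) := rfl

/-- The map `x ⊗ v ⊗ y ↦ (x ≻ φ(v)) ≺ y`. -/
def foldNode : (k × D) ⊗[k] (V ⊗[k] (k × D)) →ₗ[k] D :=
  TensorProduct.lift (unitalPrec prec).flip ∘ₗ
    (TensorProduct.lift (unitalSucc succ) ∘ₗ φ.lTensor (k × D)).rTensor (k × D) ∘ₗ
    (TensorProduct.assoc k (k × D) V (k × D)).symm.toLinearMap

theorem foldNode_tmul (x : k × D) (v : V) (y : k × D) :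
    foldNode prec succ φ (x ⊗ₜ (v ⊗ₜ y)) = unitalPrec prec y (unitalSucc succ x (φ v)) := rfl

/-- The homomorphism extending `φ` on the decorations of a fixed shape. -/
def foldAt : (t : Shape) → ⨂[k]^t.numNodes V →ₗ[k] k × D
  | .nil => LinearMap.inl k k D ∘ₗ
      (PiTensorProduct.isEmptyEquiv (R := k) (s := fun _ => V) (Fin 0)).toLinearMap
  | .node () l r => LinearMap.inr k k D ∘ₗ foldNode prec succ φ ∘ₗ
      TensorProduct.map (foldAt l) ((foldAt r).lTensor V) ∘ₗ (nodeEquiv l r).symm.toLinearMap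

/-- The homomorphism extending `φ`, with units adjoined. -/
def foldUnital : TreeMod k V →ₗ[k] k × D :=
  DirectSum.toModule k Shape (k × D) (foldAt prec succ φ)

/-- The dendriform homomorphism extending `φ`. -/
def fold : TreeMod' k V →ₗ[k] D := LinearMap.snd k k D ∘ₗ foldUnital prec succ φ ∘ₗ incl

theorem foldUnital_deco (t : Shape) (a : ⨂[k]^t.numNodes V) :
    foldUnital prec succ φ (deco t a) = foldAt prec succ φ t a := by
  simp only [foldUnital, deco, DirectSum.toModule_lof]

theorem foldUnital_leaf : foldUnital prec succ φ leaf = (1, 0) := by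
  refine (foldUnital_deco prec succ φ .nil _).trans ?_
  exact congrArg (fun c : k => (c, (0 : D))) (PiTensorProduct.isEmptyEquiv_apply_tprod (Fin 0) _)

theorem foldUnital_incl (X : TreeMod' k V) :
    foldUnital prec succ φ (incl X) = (0, fold prec succ φ X) := by
  refine Prod.ext ?_ rfl
  induction X using treeMod'_deco_induction with
  | h0 => simp
  | hadd x y hx hy => simp only [map_add, Prod.fst_add, hx, hy, add_zero]
  | h t a =>
    rw [incl_deco', foldUnital_deco]
    match t, a with
    | ⟨.nil, h⟩, _ => exact absurd rfl h
    | ⟨.node () l r, _⟩, a => rfl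

theorem foldAt_node (l r : Shape) (w : ⨂[k]^l.numNodes V ⊗[k] (V ⊗[k] ⨂[k]^r.numNodes V)) :
    foldAt prec succ φ (.node () l r) (nodeEquiv l r w) =
      (0, foldNode prec succ φ
        (TensorProduct.map (foldAt prec succ φ l) ((foldAt prec succ φ r).lTensor V) w)) := by
  simp only [foldAt, LinearMap.comp_apply, LinearEquiv.coe_coe, LinearEquiv.symm_apply_apply,
    LinearMap.inr_apply]

theorem fold_graft (x : TreeMod k V) (v : V) (y : TreeMod k V) :
    fold prec succ φ (graft (x ⊗ₜ (v ⊗ₜ y))) = foldNode prec succ φ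
      (foldUnital prec succ φ x ⊗ₜ (v ⊗ₜ foldUnital prec succ φ y)) := by
  induction x using treeMod_induction with
  | hadd x x' hx hx' => simp only [TensorProduct.add_tmul, map_add, hx, hx']
  | h l a =>
    induction y using treeMod_induction with
    | hadd x x' hx hx' => simp only [TensorProduct.tmul_add, map_add, hx, hx']
    | h r b =>
      rw [graft_deco, fold, LinearMap.comp_apply, LinearMap.comp_apply, incl_deco',
        foldUnital_deco, foldUnital_deco, foldUnital_deco]
      exact congrArg Prod.snd (foldAt_node prec succ φ l r _)

theorem fold_treeOne (v : V) : fold prec succ φ (treeOne k V v) = φ v := by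
  rw [treeOne_apply, fold_graft, foldUnital_leaf, foldNode_tmul, unitalPrec_apply,
    unitalSucc_apply]
  simp

variable {prec succ}

/-- The axiom `(x ≻ d) ≺ y = x ≻ (d ≺ y)` persists when `y` may be the adjoined unit. It makes the
order of attaching the two branches in `foldNode` irrelevant. -/
theorem unitalPrec_succ (hD : IsDendriform prec succ) (x d : D) (y : k × D) :
    unitalPrec prec y (succ (x ⊗ₜ d)) = succ (x ⊗ₜ unitalPrec prec y d) := by
  simp only [unitalPrec_apply, hD.succ_prec, TensorProduct.tmul_add, TensorProduct.tmul_smul,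
    map_add, map_smul]

/-- With `d` the image of the tree without its right branch, the claim is `d ≺ (y * Y) = (d ≺ y) ≺
Y`, the first axiom in the target. The image of `y * Y` requires the induction hypothesis for both
operations, since `*` is their sum; if `y` is a scalar, nothing is required. -/
theorem fold_prec_of (hD : IsDendriform prec succ) (x : TreeMod k V) (v : V) (y : TreeMod k V)
    (Y : TreeMod' k V)
    (h : (∃ c : k, y = c • leaf) ∨ ∃ X, y = incl X ∧
      fold prec succ φ (treePrec k V (X ⊗ₜ Y)) = prec (fold prec succ φ X ⊗ₜ fold prec succ φ Y) ∧
      fold prec succ φ (treeSucc k V (X ⊗ₜ Y)) = succ (fold prec succ φ X ⊗ₜ fold prec succ φ Y)) :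
    fold prec succ φ (treePrec k V (graft (x ⊗ₜ (v ⊗ₜ y)) ⊗ₜ Y)) =
      prec (fold prec succ φ (graft (x ⊗ₜ (v ⊗ₜ y))) ⊗ₜ fold prec succ φ Y) := by
  rw [prec_graft, fold_graft, fold_graft, foldNode_tmul, foldNode_tmul]
  obtain ⟨c, rfl⟩ | ⟨X, rfl, h1, h2⟩ := h
  · rw [← TensorProduct.smul_tmul', map_smul, leaf_star, map_smul, map_smul, foldUnital_incl,
      map_smul (foldUnital prec succ φ), foldUnital_leaf]
    simp [unitalPrec_apply, ← TensorProduct.smul_tmul']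
  · rw [star_incl, foldUnital_incl, foldUnital_incl, map_add, h1, h2, unitalPrec_apply,
      unitalPrec_apply]
    simp only [zero_smul, zero_add, hD.prec_prec]

/-- Moving the right branch `y` outside by `unitalPrec_succ` leaves `(X * x) ≻ φ(v) = X ≻ (x ≻
φ(v))`, the third axiom in the target. -/
theorem fold_succ_of (hD : IsDendriform prec succ) (X : TreeMod' k V) (x : TreeMod k V)
    (v : V) (y : TreeMod k V)
    (h : (∃ c : k, x = c • leaf) ∨ ∃ Y, x = incl Y ∧
      fold prec succ φ (treePrec k V (X ⊗ₜ Y)) = prec (fold prec succ φ X ⊗ₜ fold prec succ φ Y) ∧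
      fold prec succ φ (treeSucc k V (X ⊗ₜ Y)) = succ (fold prec succ φ X ⊗ₜ fold prec succ φ Y)) :
    fold prec succ φ (treeSucc k V (X ⊗ₜ graft (x ⊗ₜ (v ⊗ₜ y)))) =
      succ (fold prec succ φ X ⊗ₜ fold prec succ φ (graft (x ⊗ₜ (v ⊗ₜ y)))) := by
  rw [succ_graft, fold_graft, fold_graft, foldNode_tmul, foldNode_tmul, ← unitalPrec_succ hD]
  congr 1
  obtain ⟨c, rfl⟩ | ⟨Y, rfl, h1, h2⟩ := h
  · rw [TensorProduct.tmul_smul, map_smul, star_leaf, map_smul, map_smul, foldUnital_incl,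
      map_smul (foldUnital prec succ φ), foldUnital_leaf]
    simp [unitalSucc_apply]
  · rw [star_incl, foldUnital_incl, foldUnital_incl, map_add, h1, h2, unitalSucc_apply,
      unitalSucc_apply]
    simp only [zero_smul, zero_add, hD.succ_succ]

theorem fold_deco (hD : IsDendriform prec succ) (n : ℕ) (s t : Shape')
    (hn : s.1.numNodes + t.1.numNodes ≤ n)
    (a : ⨂[k]^s.1.numNodes V) (b : ⨂[k]^t.1.numNodes V) :
    fold prec succ φ (treePrec k V (deco' s a ⊗ₜ deco' t b)) =
        prec (fold prec succ φ (deco' s a) ⊗ₜ fold prec succ φ (deco' t b)) ∧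
      fold prec succ φ (treeSucc k V (deco' s a ⊗ₜ deco' t b)) =
        succ (fold prec succ φ (deco' s a) ⊗ₜ fold prec succ φ (deco' t b)) := by
  induction n generalizing s t with
  | zero =>
    match s, hn, a with
    | ⟨.nil, h⟩, _, _ => exact absurd rfl h
    | ⟨.node () l r, _⟩, hn, _ => exact absurd hn (by simp [BinaryTree.numNodes])
  | succ n ih =>
    match s, t, hn, a, b with
    | ⟨.nil, h⟩, _, _, _, _ => exact absurd rfl h
    | _, ⟨.nil, h⟩, _, _, _ => exact absurd rfl h
    | ⟨.node () l r, hs⟩, ⟨.node () l' r', ht⟩, hn, a, b =>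
      simp only [BinaryTree.numNodes] at hn
      constructor
      -- For `≺` only the first tree is taken apart; the second is kept as an opaque shape, with its
      -- size recorded in `hn'`. The other half exchanges the roles.
      · generalize hB : (⟨.node () l' r', ht⟩ : Shape') = t at b ih
        have hn' : r.numNodes + t.1.numNodes ≤ n := by
          subst hB; simp only [BinaryTree.numNodes]; omega
        refine deco'_join_induction (l := l) (r := r) (P := fun X =>
          fold prec succ φ (treePrec k V (X ⊗ₜ deco' t b)) =
            prec (fold prec succ φ X ⊗ₜ fold prec succ φ (deco' t b)))
          (by simp) (fun x x' hx hx' => ?_) (fun a v d => fold_prec_of φ hD _ _ _ _ ?_) a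
        · simp only [TensorProduct.add_tmul, map_add, hx, hx']
        · refine (deco_cases r d).imp_right ?_
          rintro ⟨hr, h⟩
          exact ⟨_, h, ih ⟨r, hr⟩ t hn' d b⟩
      · generalize hA : (⟨.node () l r, hs⟩ : Shape') = s at a ih
        have hn' : s.1.numNodes + l'.numNodes ≤ n := by
          subst hA; simp only [BinaryTree.numNodes]; omega
        refine deco'_join_induction (l := l') (r := r') (P := fun X =>
          fold prec succ φ (treeSucc k V (deco' s a ⊗ₜ X)) =
            succ (fold prec succ φ (deco' s a) ⊗ₜ fold prec succ φ X))
          (by simp) (fun x x' hx hx' => ?_) (fun d v c => fold_succ_of φ hD _ _ _ _ ?_) b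
        · simp only [TensorProduct.tmul_add, map_add, hx, hx']
        · refine (deco_cases l' d).imp_right ?_
          rintro ⟨hl, h⟩
          exact ⟨_, h, ih s ⟨l', hl⟩ hn' a d⟩

theorem fold_prec (hD : IsDendriform prec succ) :
    fold prec succ φ ∘ₗ treePrec k V =
      prec ∘ₗ TensorProduct.map (fold prec succ φ) (fold prec succ φ) :=
  directSum_tensor_ext fun s t a b => (fold_deco φ hD _ s t le_rfl a b).1

theorem fold_succ (hD : IsDendriform prec succ) :
    fold prec succ φ ∘ₗ treeSucc k V =
      succ ∘ₗ TensorProduct.map (fold prec succ φ) (fold prec succ φ) :=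
  directSum_tensor_ext fun s t a b => (fold_deco φ hD _ s t le_rfl a b).2

end Fold

/-! ### Decorated trees inside shapes tensored with the tensor algebra -/

section Embedding

variable {k : Type*} [Field k] {V : Type*} [AddCommGroup V] [Module k V]

variable (k) in
/-- The tensor `1 ⊗ ⋯ ⊗ 1`. -/
def ones (n : ℕ) : ⨂[k]^n k := PiTensorProduct.tprod k fun _ => 1

variable (k) in
/-- The tree of shape `t` with all decorations equal to `1`. -/
def plainTree (t : Shape') : TreeMod' k k := deco' t (ones k _)

theorem nodeEquiv_ones (l r : Shape) :
    nodeEquiv l r (ones k l.numNodes ⊗ₜ ((1 : k) ⊗ₜ ones k r.numNodes)) =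
      ones k (BinaryTree.node () l r).numNodes := by
  have h : ∀ {m n : ℕ},
      TensorPower.mulEquiv (ones k m ⊗ₜ[k] ones k n) = ones k (m + n) := by
    intro m n
    refine (TensorPower.tprod_mul_tprod k (fun _ : Fin m => (1 : k))
      fun _ : Fin n => (1 : k)).trans (congrArg _ (funext fun i => ?_))
    refine Fin.addCases (fun i => ?_) (fun i => ?_) i <;> simp
  have h1 : (PiTensorProduct.subsingletonEquiv (R := k) (s := fun _ => k) (0 : Fin 1)).symm 1 =
      ones k 1 := by
    rw [LinearEquiv.symm_apply_eq]
    simp [ones]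
  simp only [nodeEquiv, LinearEquiv.trans_apply, TensorProduct.congr_tmul,
    LinearEquiv.refl_apply, h1, h]
  exact TensorPower.cast_tprod (R := k) (M := k) _ _

theorem graft_plain (l r : Shape) :
    graft (deco l (ones k _) ⊗ₜ ((1 : k) ⊗ₜ deco r (ones k _))) = plainTree k (join l r) := by
  rw [graft_deco, nodeEquiv_ones]
  rfl

theorem deco_nil_ones : deco .nil (ones k _) = (leaf : TreeMod k k) := by
  unfold leaf ones
  congr 2
  exact funext fun i => i.elim0

theorem pow_nodeEquiv (l r : Shape) (a : ⨂[k]^l.numNodes V) (v : V) (b : ⨂[k]^r.numNodes V) :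
    pow _ (nodeEquiv l r (a ⊗ₜ (v ⊗ₜ b))) = pow _ a * (gen v * pow _ b) := by
  simp only [nodeEquiv, LinearEquiv.trans_apply, TensorProduct.congr_tmul,
    LinearEquiv.refl_apply, pow_cast, pow_mulEquiv]
  rfl

variable (k V) in
/-- The embedding of decorated trees in plain trees tensored with the tensor algebra. -/
def shapeWord : TreeMod' k V →ₗ[k] TreeMod' k k ⊗[k] TAlg k V :=
  fold (tensorOp (treePrec k k) (LinearMap.mul' k (TAlg k V)))
    (tensorOp (treeSucc k k) (LinearMap.mul' k (TAlg k V)))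
    (TensorProduct.mk k (TreeMod' k k) (TAlg k V) (treeOne k k 1) ∘ₗ gen)

variable (k V) in
theorem shapes_isDendriform :
    IsDendriform (tensorOp (treePrec k k) (LinearMap.mul' k (TAlg k V)))
      (tensorOp (treeSucc k k) (LinearMap.mul' k (TAlg k V))) :=
  tensorOp_isDendriform (tree_isDendriform k k) fun x y z => by
    simp only [LinearMap.mul'_apply, mul_assoc]

variable (k V) in
/-- `shapeWord` with units adjoined. -/
abbrev shapeWordUnital : TreeMod k V →ₗ[k] k × (TreeMod' k k ⊗[k] TAlg k V) :=
  foldUnital (tensorOp (treePrec k k) (LinearMap.mul' k (TAlg k V)))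
    (tensorOp (treeSucc k k) (LinearMap.mul' k (TAlg k V)))
    (TensorProduct.mk k (TreeMod' k k) (TAlg k V) (treeOne k k 1) ∘ₗ gen)

/-- The same scalar must appear in the tree and in the word, so that an empty branch contributes
equally to both components of `shapeWord`. -/
theorem exists_smul_one (a : ⨂[k]^0 V) :
    ∃ c : k, deco BinaryTree.nil a = c • (leaf : TreeMod k V) ∧ pow 0 a = c • 1 := by
  obtain ⟨c, rfl⟩ := (PiTensorProduct.isEmptyEquiv (R := k) (s := fun _ => V)
    (Fin 0)).symm.surjective a
  refine ⟨c, ?_, ?_⟩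
  · rw [deco_nil, LinearEquiv.apply_symm_apply]
  · rw [PiTensorProduct.isEmptyEquiv_symm_apply, map_smul, ← pow_zero_tprod]
    congr 3

/-- Attaching a left branch to a one-vertex tree puts the word of that branch in front of the word
of the root. Its counterpart `unitalPrec_shapeWord` puts the word of the right branch behind;
together they give in-order reading. -/
theorem unitalSucc_shapeWord (l : Shape) (a : ⨂[k]^l.numNodes V)
    (ih : ∀ h : l ≠ .nil, shapeWord k V (deco' ⟨l, h⟩ a) = plainTree k ⟨l, h⟩ ⊗ₜ pow _ a)
    (w : TAlg k V) :
    unitalSucc (tensorOp (treeSucc k k) (LinearMap.mul' k (TAlg k V)))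
        (shapeWordUnital k V (deco l a)) (treeOne k k 1 ⊗ₜ w) =
      graft (deco l (ones k _) ⊗ₜ ((1 : k) ⊗ₜ leaf)) ⊗ₜ (pow _ a * w) := by
  match l, a, ih with
  | .nil, a, _ =>
    obtain ⟨c, h1, h2⟩ := exists_smul_one a
    rw [h1, map_smul, foldUnital_leaf, deco_nil_ones, unitalSucc_apply]
    erw [h2]
    simp [treeOne_apply]
  | .node () l r, a, ih =>
    rw [← incl_deco' (join l r) a, foldUnital_incl, unitalSucc_apply]
    erw [ih (by simp)]
    rw [tensorOp_tmul, treeOne_apply, succ_graft_leaf, plainTree, incl_deco', zero_smul, zero_add]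
    rfl

theorem unitalPrec_shapeWord (p : TreeMod k k) (r : Shape) (b : ⨂[k]^r.numNodes V)
    (ih : ∀ h : r ≠ .nil, shapeWord k V (deco' ⟨r, h⟩ b) = plainTree k ⟨r, h⟩ ⊗ₜ pow _ b)
    (w : TAlg k V) :
    unitalPrec (tensorOp (treePrec k k) (LinearMap.mul' k (TAlg k V)))
        (shapeWordUnital k V (deco r b)) (graft (p ⊗ₜ ((1 : k) ⊗ₜ leaf)) ⊗ₜ w) =
      graft (p ⊗ₜ ((1 : k) ⊗ₜ deco r (ones k _))) ⊗ₜ (w * pow _ b) := by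
  match r, b, ih with
  | .nil, b, _ =>
    obtain ⟨c, h1, h2⟩ := exists_smul_one b
    rw [h1, map_smul, foldUnital_leaf, deco_nil_ones, unitalPrec_apply]
    erw [h2]
    simp
  | .node () l r, b, ih =>
    rw [← incl_deco' (join l r) b, foldUnital_incl, unitalPrec_apply]
    erw [ih (by simp)]
    rw [tensorOp_tmul, prec_graft_leaf, plainTree, incl_deco', zero_smul, zero_add]
    rfl

/-- The homomorphism defined on generators is identified with the map "shape and in-order word".
From its definition through `fold` come the multiplicative properties; from this formula come
injectivity and the behaviour of the braiding. -/
theorem shapeWord_deco' (t : Shape') (a : ⨂[k]^t.1.numNodes V) :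
    shapeWord k V (deco' t a) = plainTree k t ⊗ₜ pow _ a := by
  obtain ⟨t, ht⟩ := t
  induction t with
  | nil => exact absurd rfl ht
  | node u l r ihl ihr =>
    obtain ⟨w, rfl⟩ := (nodeEquiv l r).surjective a
    suffices h : shapeWord k V ∘ₗ deco' (join l r) ∘ₗ (nodeEquiv l r).toLinearMap =
        TensorProduct.mk k _ _ (plainTree k (join l r)) ∘ₗ pow _ ∘ₗ (nodeEquiv l r).toLinearMap from
      LinearMap.congr_fun h w
    refine TensorProduct.ext' fun a w => ?_
    induction w using TensorProduct.induction_on with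
    | zero => simp
    | add w w' h1 h2 => simp only [TensorProduct.tmul_add, map_add, h1, h2]
    | tmul v b =>
      simp only [LinearMap.comp_apply, LinearEquiv.coe_coe, pow_nodeEquiv]
      refine (congrArg _ (graft_deco l r a v b).symm).trans ?_
      rw [shapeWord, fold_graft, foldNode_tmul]
      simp only [LinearMap.comp_apply, TensorProduct.mk_apply]
      rw [unitalSucc_shapeWord l a fun h => ihl h a,
        unitalPrec_shapeWord _ r b fun h => ihr h b, graft_plain, mul_assoc]

theorem shapeWord_prec : shapeWord k V ∘ₗ treePrec k V =
    tensorOp (treePrec k k) (LinearMap.mul' k (TAlg k V)) ∘ₗ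
      TensorProduct.map (shapeWord k V) (shapeWord k V) :=
  fold_prec _ (shapes_isDendriform k V)

theorem shapeWord_succ : shapeWord k V ∘ₗ treeSucc k V =
    tensorOp (treeSucc k k) (LinearMap.mul' k (TAlg k V)) ∘ₗ
      TensorProduct.map (shapeWord k V) (shapeWord k V) :=
  fold_succ _ (shapes_isDendriform k V)

variable (k) in
/-- The coefficient of the plain tree of shape `t`. -/
def coefficient (t : Shape') : TreeMod' k k →ₗ[k] k :=
  (PiTensorProduct.constantBaseRingEquiv (Fin t.1.numNodes) k).toLinearMap ∘ₗ
    DirectSum.component k Shape' (fun t : Shape' => ⨂[k]^t.1.numNodes k) t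

theorem coefficient_plainTree_self (t : Shape') : coefficient k t (plainTree k t) = 1 := by
  simp only [coefficient, plainTree, deco', LinearMap.comp_apply, DirectSum.component.lof_self,
    ones]
  simp

theorem coefficient_plainTree_of_ne {s t : Shape'} (h : t ≠ s) :
    coefficient k t (plainTree k s) = 0 := by
  simp only [coefficient, plainTree, deco', LinearMap.comp_apply, DirectSum.component.of,
    dif_neg h.symm, map_zero]

/-- Reading off the coefficient of one plain tree recovers the decorations of that shape; as `pow`
is injective in each degree, an element is determined by its image. -/
theorem coefficient_shapeWord (t : Shape') (x : TreeMod' k V) :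
    TensorProduct.lid k _ ((coefficient k t).rTensor (TAlg k V) (shapeWord k V x)) =
      pow _ (x t) := by
  induction x using treeMod'_deco_induction with
  | h0 => simp
  | hadd x y hx hy => simp only [map_add, hx, hy, DirectSum.add_apply]
  | h s a =>
    rw [shapeWord_deco', LinearMap.rTensor_tmul, TensorProduct.lid_tmul]
    by_cases h : t = s
    · subst h
      rw [coefficient_plainTree_self, one_smul, deco', DirectSum.lof_apply]
    · rw [coefficient_plainTree_of_ne h, zero_smul, deco', DirectSum.lof_eq_of,
        DirectSum.of_eq_of_ne _ _ _ h, map_zero]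

variable (k V) in
theorem shapeWord_injective : Function.Injective (shapeWord k V) := by
  intro x y h
  refine DFinsupp.ext fun t => pow_injective _ ?_
  exact (coefficient_shapeWord t x).symm.trans
    ((congrArg _ (congrArg _ h)).trans (coefficient_shapeWord t y))

variable (σ : V ⊗[k] V →ₗ[k] V ⊗[k] V)

theorem treeBraiding_deco' (s t : Shape') (a : ⨂[k]^s.1.numNodes V) (b : ⨂[k]^t.1.numNodes V) :
    treeBraiding σ (deco' s a ⊗ₜ deco' t b) =
      TensorProduct.map (deco' t) (deco' s) (braidAt σ _ _ (a ⊗ₜ b)) :=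
  sumTensorLift_lof (fun s t : Shape' =>
    TensorProduct.map (deco' t) (deco' s) ∘ₗ TensorPower.mulEquiv.symm.toLinearMap ∘ₗ
      (TensorPower.cast k V (Nat.add_comm s.1.numNodes t.1.numNodes)).toLinearMap ∘ₗ
      beta σ s.1.numNodes t.1.numNodes ∘ₗ TensorPower.mulEquiv.toLinearMap) s t a b

/-- On fixed shapes, `σ_BT` exchanges the shapes and applies the block braiding to the words, which
is `flipBraiding` with the plain trees as labels. -/
theorem shapeWord_isBraidedHom : IsBraidedHom (treeBraiding σ)
    (flipBraiding (TreeMod' k k) (tensorBraiding σ)) (shapeWord k V) := by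
  refine directSum_tensor_ext fun s t a b => ?_
  have h1 : ∀ w : ⨂[k]^t.1.numNodes V ⊗[k] ⨂[k]^s.1.numNodes V,
      TensorProduct.map (shapeWord k V) (shapeWord k V)
        (TensorProduct.map (deco' t) (deco' s) w) =
      labelTwo k (TAlg k V) (plainTree k t) (plainTree k s)
        (TensorProduct.map (pow _) (pow _) w) := by
    intro w
    induction w using TensorProduct.induction_on with
    | zero => simp
    | add w w' h1 h2 => simp only [map_add, h1, h2]
    | tmul x y =>
      simp only [TensorProduct.map_tmul, shapeWord_deco']
      rfl
  change TensorProduct.map _ _ (treeBraiding σ (deco' s a ⊗ₜ deco' t b)) =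
    flipBraiding _ _ (shapeWord k V (deco' s a) ⊗ₜ shapeWord k V (deco' t b))
  rw [treeBraiding_deco', h1, ← tensorBraiding_map, ← flipBraiding_labelTwo, shapeWord_deco',
    shapeWord_deco']
  rfl

theorem shapeWord_treeOne (v : V) :
    shapeWord k V (treeOne k V v) = treeOne k k 1 ⊗ₜ gen v := fold_treeOne _ _ _ v

theorem mk_gen_isBraidedHom (s : TreeMod' k k) :
    IsBraidedHom σ (flipBraiding (TreeMod' k k) (tensorBraiding σ))
      (TensorProduct.mk k (TreeMod' k k) (TAlg k V) s ∘ₗ gen) := by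
  refine TensorProduct.ext' fun u v => ?_
  have h := flipBraiding_labelTwo (tensorBraiding σ) s s (gen u ⊗ₜ gen v)
  rw [tensorBraiding_gen, labelTwo] at h
  rw [TensorProduct.map_comp]
  exact h.symm

theorem treeOne_isBraidedHom : IsBraidedHom σ (treeBraiding σ) (treeOne k V) := by
  refine (shapeWord_isBraidedHom σ).of_comp_injective (shapeWord_injective k V) ?_
  have h : shapeWord k V ∘ₗ treeOne k V =
      TensorProduct.mk k (TreeMod' k k) (TAlg k V) (treeOne k k 1) ∘ₗ gen :=
    LinearMap.ext shapeWord_treeOne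
  rw [h]
  exact mk_gen_isBraidedHom σ _

variable {σ} in
theorem tree_isBraidedDendriform (hσ : IsBraiding σ) :
    IsBraidedDendriform (treePrec k V) (treeSucc k V) (treeBraiding σ) where
  braiding := (flipBraiding_isBraiding (tensorBraiding_isBraiding hσ)).of_injective
    (shapeWord_isBraidedHom σ) (shapeWord_injective k V)
  dendriform := tree_isDendriform k V
  compat_prec := (flipBraiding_isCompatible (tensorBraiding_isCompatible σ)).of_injective
    (shapeWord_isBraidedHom σ) (shapeWord_injective k V) shapeWord_prec
  compat_succ := (flipBraiding_isCompatible (tensorBraiding_isCompatible σ)).of_injective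
    (shapeWord_isBraidedHom σ) (shapeWord_injective k V) shapeWord_succ

end Embedding

end BraidedDend

end

/-! ### The freeness theorem -/

theorem mainTheorem3 {k : Type*} [Field k] [CharZero k] {V : Type*} [AddCommGroup V] [Module k V]
    (σ : V ⊗[k] V →ₗ[k] V ⊗[k] V) (hσ : BraidedDend.IsBraiding σ) :
    BraidedDend.IsBraidedDendriform (BraidedDend.treePrec k V) (BraidedDend.treeSucc k V)
        (BraidedDend.treeBraiding σ) ∧
      BraidedDend.IsBraidedHom σ (BraidedDend.treeBraiding σ) (BraidedDend.treeOne k V) ∧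
      ∀ {D : Type*} [AddCommGroup D] [Module k D] (prec succ : D ⊗[k] D →ₗ[k] D)
        (τ : D ⊗[k] D →ₗ[k] D ⊗[k] D), BraidedDend.IsBraidedDendriform prec succ τ →
        ∀ φ : V →ₗ[k] D, BraidedDend.IsBraidedHom σ τ φ →
          ∃! f : BraidedDend.TreeMod' k V →ₗ[k] D,
            BraidedDend.IsBraidedDendriformHom (BraidedDend.treePrec k V)
                (BraidedDend.treeSucc k V) (BraidedDend.treeBraiding σ) prec succ τ f ∧
              f ∘ₗ BraidedDend.treeOne k V = φ := by
  have hT := BraidedDend.tree_isBraidedDendriform hσ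
  have hi := BraidedDend.treeOne_isBraidedHom σ
  have hgen := BraidedDend.tree_isGenerated k V
  refine ⟨hT, hi, fun {D} _ _ prec succ τ hD φ hφ => ?_⟩
  have h1 := BraidedDend.fold_prec φ hD.dendriform
  have h2 := BraidedDend.fold_succ φ hD.dendriform
  have h3 : BraidedDend.fold prec succ φ ∘ₗ BraidedDend.treeOne k V = φ :=
    LinearMap.ext (BraidedDend.fold_treeOne prec succ φ)
  refine ⟨BraidedDend.fold prec succ φ, ⟨⟨h1, h2, ?_⟩, h3⟩, ?_⟩
  -- On generators the extension is `φ`, which is braided by assumption; compatibility on both sides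
  -- propagates this to all trees.
  · exact hgen.isBraidedHom hi (by rwa [h3]) hT.compat_prec hT.compat_succ hD.compat_prec
      hD.compat_succ h1 h2
  · rintro g ⟨hg, hgφ⟩
    -- Uniqueness already holds among dendriform homomorphisms, so the braided condition on `g`
    -- plays no part.
    exact hgen.hom_ext hg.map_prec hg.map_succ h1 h2 (hgφ.trans h3.symm)
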